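/- Let $k$ be an algebraically closed field of characteristic zero, let $n\ge 3$ and $d\ge 4$ be integers, and let $R=k[x_0,\dots,x_n]$. An ideal $I\subset R$ is called a *Togliatti system* of forms of degree $d$ if $R/I$ is artinian, $I$ is generated by $r\le\binom{n+d-1}{n-1}$ forms of degree $d$, and $I$ fails the weak Lefschetz property in degree $d-1$, that is, for a general linear form $L$ the multiplication map $\times L\colon (R/I)_{d-1}\to (R/I)_d$ is neither injective nor surjective. It is a *minimal monomial* Togliatti system if moreover it is generated by monomials $m_1,\dots,m_r$ of degree $d$ such that no proper subset of $\{m_1,\dots,m_r\}$ generates a Togliatti system of forms of degree $d$. A minimal monomial Togliatti system $I$ is called *smooth* if the projective variety $X$ is smooth, where $X$ is the closure of the image of the rational map from $\mathbb{P}^n$ to a projective space given by all monomials of degree $d$ that do not belong to $I$. Then there is no smooth minimal monomial Togliatti system $I\subset R$ of forms of degree $d$ whose minimal number of generators $\mu(I)$ equals $2n+3$. -/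

import Mathlib

/-! Monomial Togliatti systems in `R = k[x_0, …, x_n]`, and the smoothness of the projective
variety parametrized by the apolar linear system. -/

/-- The degree `j` component `(R/I)_j` of `R/I`: the classes of the forms of degree `j`. -/
noncomputable def gradedPiece {k : Type*} [Field k] {n : ℕ}
    (I : Ideal (MvPolynomial (Fin (n + 1)) k)) (j : ℕ) :
    Submodule k (MvPolynomial (Fin (n + 1)) k ⧸ I) :=
  (MvPolynomial.homogeneousSubmodule (Fin (n + 1)) k j).map
    (Ideal.Quotient.mkₐ k I).toLinearMap

/-- The linear form `c_0 x_0 + ⋯ + c_n x_n`. -/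
noncomputable def linearForm {k : Type*} [Field k] {n : ℕ} (c : Fin (n + 1) → k) :
    MvPolynomial (Fin (n + 1)) k :=
  ∑ i, MvPolynomial.C (c i) * MvPolynomial.X i

/-- The multiplication map `×L : (R/I)_j → (R/I)_{j+1}` has maximal rank, i.e. it is injective
or surjective. -/
def MulHasMaximalRank {k : Type*} [Field k] {n : ℕ}
    (I : Ideal (MvPolynomial (Fin (n + 1)) k)) (L : MvPolynomial (Fin (n + 1)) k) (j : ℕ) :
    Prop :=
  (∀ f ∈ gradedPiece I j, Ideal.Quotient.mk I L * f = 0 → f = 0) ∨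
    (∀ g ∈ gradedPiece I (j + 1), ∃ f ∈ gradedPiece I j, Ideal.Quotient.mk I L * f = g)

/-- `I` fails the weak Lefschetz property in degree `j`: for the general linear form `L` (that is,
for all `L` whose coefficient vector lies in some nonempty Zariski open set, which may be taken to
be the complement of the zeros of a nonzero polynomial `G`), the map
`×L : (R/I)_j → (R/I)_{j+1}` does not have maximal rank. -/
def FailsWLPInDegree {k : Type*} [Field k] {n : ℕ}
    (I : Ideal (MvPolynomial (Fin (n + 1)) k)) (j : ℕ) : Prop :=
  ∃ G : MvPolynomial (Fin (n + 1)) k, G ≠ 0 ∧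
    ∀ c : Fin (n + 1) → k, MvPolynomial.eval c G ≠ 0 → ¬ MulHasMaximalRank I (linearForm c) j

/-- `I` is a Togliatti system of forms of degree `d`: an artinian ideal generated by
`r ≤ binom(n+d-1, n-1)` forms of degree `d` which fails the weak Lefschetz property in
degree `d - 1`. -/
structure IsTogliattiSystem {k : Type*} [Field k] (n d : ℕ)
    (I : Ideal (MvPolynomial (Fin (n + 1)) k)) : Prop where
  artinian : IsArtinianRing (MvPolynomial (Fin (n + 1)) k ⧸ I)
  generated : ∃ S : Finset (MvPolynomial (Fin (n + 1)) k),
    (∀ F ∈ S, F.IsHomogeneous d) ∧ I = Ideal.span (S : Set (MvPolynomial (Fin (n + 1)) k)) ∧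
      S.card ≤ (n + d - 1).choose (n - 1)
  fails_wlp : FailsWLPInDegree I (d - 1)

/-- The ideal generated by the monomials `x^a`, `a ∈ S`. -/
noncomputable def monomialIdeal (k : Type*) [Field k] {n : ℕ} (S : Finset (Fin (n + 1) →₀ ℕ)) :
    Ideal (MvPolynomial (Fin (n + 1)) k) :=
  Ideal.span ((fun a => MvPolynomial.monomial a (1 : k)) '' (S : Set (Fin (n + 1) →₀ ℕ)))

/-- `I` is a minimal monomial Togliatti system of forms of degree `d`: a Togliatti system generated
by monomials of degree `d` such that no proper subset of them generates a Togliatti system. -/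
def IsMinimalMonomialTogliattiSystem {k : Type*} [Field k] (n d : ℕ)
    (I : Ideal (MvPolynomial (Fin (n + 1)) k)) : Prop :=
  IsTogliattiSystem n d I ∧
    ∃ S : Finset (Fin (n + 1) →₀ ℕ), (∀ a ∈ S, a.degree = d) ∧ I = monomialIdeal k S ∧
      ∀ T : Finset (Fin (n + 1) →₀ ℕ), T ⊂ S → ¬ IsTogliattiSystem n d (monomialIdeal k T)

open Classical in
/-- The exponents `a` of the monomials of degree `d` that are not in `I`. For a monomial ideal `I`
these monomials form a basis of the degree `d` part of the Macaulay inverse system of `I`. -/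
noncomputable def apolarExponents {k : Type*} [Field k] {n : ℕ} (d : ℕ)
    (I : Ideal (MvPolynomial (Fin (n + 1)) k)) : Finset (Fin (n + 1) →₀ ℕ) :=
  (Finset.univ.finsuppAntidiag d).filter fun a => MvPolynomial.monomial a (1 : k) ∉ I

/-- The map `x ↦ (x^a)_{a ∈ A}`. On homogeneous coordinates it is the rational map from `ℙ^n`
given by the monomials with exponents in `A`. -/
def monomialMap (k : Type*) [Field k] {n : ℕ} (A : Finset (Fin (n + 1) →₀ ℕ))
    (x : Fin (n + 1) → k) : A → k :=
  fun a => ∏ i, x i ^ (a : Fin (n + 1) →₀ ℕ) i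

/-- The homogeneous ideal, in the polynomial ring `k[y_a : a ∈ A]`, of the closure `X` of the image
of the rational map given by the monomials of degree `d` not in `I`. (All these monomials have
the same degree, so over an algebraically closed field the range of `monomialMap` is a cone,
and the polynomials vanishing on it form the homogeneous ideal of `X`.) -/
noncomputable def apolarVarietyIdeal {k : Type*} [Field k] {n : ℕ} (d : ℕ)
    (I : Ideal (MvPolynomial (Fin (n + 1)) k)) :
    Ideal (MvPolynomial (apolarExponents d I) k) :=
  MvPolynomial.vanishingIdeal k (Set.range (monomialMap k (apolarExponents d I)))

/-- The Zariski tangent space at `p` of the affine scheme defined by `J`, i.e. the kernel at `p`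
of the Jacobian matrix of the elements of `J`. -/
noncomputable def zariskiTangentSpace {k ι : Type*} [Field k] [Fintype ι]
    (J : Ideal (MvPolynomial ι k)) (p : ι → k) : Submodule k (ι → k) where
  carrier := {v | ∀ f ∈ J, ∑ i, MvPolynomial.eval p (MvPolynomial.pderiv i f) * v i = 0}
  zero_mem' := by intro f _; simp
  add_mem' := by
    intro v w hv hw f hf
    simp only [Pi.add_apply, mul_add, Finset.sum_add_distrib, hv f hf, hw f hf, add_zero]
  smul_mem' := by
    intro c v hv f hf
    simp only [Pi.smul_apply, smul_eq_mul, mul_left_comm _ c, ← Finset.mul_sum, hv f hf, mul_zero]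

/-- Jacobian criterion: the irreducible projective variety `X` with homogeneous ideal `J` is smooth
if at every point `[p]` of `X` (`p ≠ 0` a zero of `J`) the tangent space of the affine cone over `X`
has dimension `dim X + 1`, the Krull dimension of the homogeneous coordinate ring of `X`. -/
def IsSmoothProjectiveVariety {k ι : Type*} [Field k] [Fintype ι]
    (J : Ideal (MvPolynomial ι k)) : Prop :=
  ∀ p ∈ MvPolynomial.zeroLocus k J, p ≠ 0 →
    (Module.finrank k (zariskiTangentSpace J p) : WithBot ℕ∞) =
      ringKrullDim (MvPolynomial ι k ⧸ J)

/-- The set of all smooth minimal monomial Togliatti systems of forms of degree `d` in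
`k[x_0, …, x_n]`. -/
def smoothMinimalMonomialTogliattiSystems (k : Type*) [Field k] (n d : ℕ) :
    Set (Ideal (MvPolynomial (Fin (n + 1)) k)) :=
  {I | IsMinimalMonomialTogliattiSystem n d I ∧
    IsSmoothProjectiveVariety (apolarVarietyIdeal d I)}

/-! Let `S` be the exponent set of a minimal set of monomial generators. Since the quotient is
artinian, `S` contains all `n + 1` powers `x_i^d`. Failure of injectivity, after rescaling the
variables, gives a form `F ≠ 0` of degree `d - 1` with every monomial of `(x_0 + ⋯ + x_n) F` in `S`.
Conversely any such `F` certifies the failure, so by minimality every generator other than a power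
occurs in the product. With `2n + 3` generators there are `n + 2` non-powers, forming a set `M`. A
monomial `F` is then impossible, as it yields only `n + 1` products.

If no power of a variable occurs in the product, its support lies in `M`. But a non-monomial times
the sum of `n + 1` variables has at least `2n` monomials (`two_mul_card_le_ncard_support_shiftSum`),
and `2n > n + 2` for `n ≥ 3`.

If some power occurs, smoothness enters. The variety is toric. At a vertex `v` of the polytope of
the remaining exponents `A`, the tangent space contains a coordinate vector for each indecomposable
element, so smoothness allows at most `n + 1` of these. They also span `ℚ^(n+1)`, hence are linearly
independent, and at most three lie on a coordinate triangle. Suppose that `x_i^(d-1) x_l` is a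
generator but some monomial of the edge `{i, l}` is not. The local structure at the vertices
`x_i^(d-1) x_j` then forces three further generators for each variable other than `x_i` and `x_l`,
in all at least `4n - 1 > 2n + 3` generators. So an edge having a generator next to one of its ends
is full (`edgePoint_mem_of_smooth`).

On an edge the product is divisible by the sum of the two variables, and by its square if the
adjacent parallel line in some triangle carries no monomial of the product. Divisibility by the
square forces additional monomials inside the edge. Together with full edges this gives at least six
elements of `M` on a tetrahedron having a vertex whose power occurs, and by induction at least `|T|
+ 2` on such a face `T` with `|T| ≥ 4` (`IsEdgeFull.card_add_two_le`). For all variables this is `n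
+ 3 > n + 2`. -/

/-- The coefficients of the product of `∑_{i ∈ T} x_i` with the polynomial with coefficients
`φ`. -/
noncomputable def shiftSum {σ k : Type*} [AddCommMonoid k] (T : Finset σ)
    (φ : (σ →₀ ℕ) → k) (a : σ →₀ ℕ) : k :=
  ∑ i ∈ T, if a i = 0 then 0 else φ (a - Finsupp.single i 1)

/-! ### Exponent vectors: degree and order. -/

section Exponents

variable {σ : Type*}

theorem Finsupp.eq_of_le_of_degree_le {a b : σ →₀ ℕ} (h : a ≤ b) (hd : b.degree ≤ a.degree) :
    a = b := by
  obtain ⟨c, rfl⟩ := exists_add_of_le h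
  rw [map_add] at hd
  have : c = 0 := (Finsupp.degree_eq_zero_iff c).1 (by omega)
  simp [this]

theorem Finsupp.exists_lt_of_degree_lt {a b : σ →₀ ℕ} (h : a.degree < b.degree) :
    ∃ i, a i < b i := by
  by_contra! hc
  exact absurd (Finsupp.degree_mono (show b ≤ a from hc)) (by omega)

theorem Finsupp.sub_single_add_single {a : σ →₀ ℕ} {i : σ} (h : a i ≠ 0) :
    a - Finsupp.single i 1 + Finsupp.single i 1 = a :=
  tsub_add_cancel_of_le (Finsupp.single_le_iff.2 (Nat.one_le_iff_ne_zero.2 h))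

theorem Finsupp.degree_sub_single {a : σ →₀ ℕ} {i : σ} (h : a i ≠ 0) :
    (a - Finsupp.single i 1).degree + 1 = a.degree := by
  conv_rhs => rw [← Finsupp.sub_single_add_single h, map_add, Finsupp.degree_single]

theorem Finsupp.sub_single_apply_of_ne {a : σ →₀ ℕ} {i j : σ} (h : j ≠ i) :
    (a - Finsupp.single i 1 : σ →₀ ℕ) j = a j := by
  classical
  simp [h.symm]

end Exponents

/-! ### Multiplication by a sum of variables, on coefficients. -/

section ShiftSum

variable {σ k : Type*} [Field k]

theorem exists_of_shiftSum_ne_zero {T : Finset σ} {φ : (σ →₀ ℕ) → k} {a : σ →₀ ℕ}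
    (h : shiftSum T φ a ≠ 0) : ∃ i ∈ T, a i ≠ 0 ∧ φ (a - Finsupp.single i 1) ≠ 0 := by
  obtain ⟨i, hi, h⟩ := Finset.exists_ne_zero_of_sum_ne_zero h
  by_cases hc : a i = 0
  · simp [hc] at h
  · exact ⟨i, hi, hc, by simpa [hc] using h⟩

theorem shiftSum_eq_add [DecidableEq σ] {T : Finset σ} (φ : (σ →₀ ℕ) → k)
    (a : σ →₀ ℕ) {q : σ} (hq : q ∈ T) :
    shiftSum T φ a = (if a q = 0 then 0 else φ (a - Finsupp.single q 1)) +
      shiftSum (T.erase q) φ a := by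
  exact (Finset.add_sum_erase T (fun i => if a i = 0 then 0 else φ (a - Finsupp.single i 1))
    hq).symm

theorem shiftSum_add_single [DecidableEq σ] {T : Finset σ} (φ : (σ →₀ ℕ) → k)
    (a : σ →₀ ℕ) {q : σ} (hq : q ∈ T) :
    shiftSum T φ (a + Finsupp.single q 1) = φ a +
      shiftSum (T.erase q) φ (a + Finsupp.single q 1) := by
  rw [shiftSum_eq_add _ _ hq]
  simp

theorem finite_support_shiftSum (T : Finset σ) {φ : (σ →₀ ℕ) → k}
    (hφ : (Function.support φ).Finite) : (Function.support (shiftSum T φ)).Finite := by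
  refine (T.finite_toSet.biUnion fun i _ => hφ.image (· + Finsupp.single i 1)).subset ?_
  intro a ha
  obtain ⟨i, hi, h0, h⟩ := exists_of_shiftSum_ne_zero ha
  exact Set.mem_biUnion hi ⟨_, h, Finsupp.sub_single_add_single h0⟩

/-- If no monomial of `φ` has lower `q`-degree than `p`, and `p` is the only one of its
`q`-degree, then all the multiples `x_i p`, `i ≠ q`, occur in the product. -/
theorem shiftSum_ne_zero_of_unique_min {T : Finset σ} {φ : (σ →₀ ℕ) → k} {p : σ →₀ ℕ} {q : σ}
    (hp : φ p ≠ 0) (hmin : ∀ a, φ a ≠ 0 → a ≠ p → p q < a q) {i : σ} (hi : i ∈ T) (hiq : i ≠ q) :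
    shiftSum T φ (p + Finsupp.single i 1) ≠ 0 := by
  classical
  rw [shiftSum_add_single _ _ hi, shiftSum, Finset.sum_eq_zero, add_zero]
  · exact hp
  · intro j hj
    split_ifs with h
    · rfl
    · by_contra hne
      have hji := Finset.ne_of_mem_erase hj
      have h1 := hmin _ hne ?_
      · simp [hiq] at h1
        have : (p + Finsupp.single i 1 - Finsupp.single j 1 : σ →₀ ℕ) q ≤ p q := by
          simp [hiq]
        omega
      · intro he
        have := DFunLike.congr_fun he i
        simp [hji] at this

end ShiftSum

/-! ### Lower bound for the number of monomials of a multiple of a sum of variables. -/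

section ShiftSum

variable {σ k : Type*} [Field k]

theorem card_add_card_le_ncard {α : Type*} {s t u : Set α} (hu : u.Finite) (hs : s ⊆ u)
    (ht : t ⊆ u) (hst : ∀ a ∈ s, a ∉ t) : s.ncard + t.ncard ≤ u.ncard := by
  rw [← Set.ncard_union_eq (Set.disjoint_left.2 hst) (hu.subset hs) (hu.subset ht)]
  exact Set.ncard_le_ncard (Set.union_subset hs ht) hu

/-- The case of the lower bound for the number of monomials in which some lowest layers consist of
a single monomial. -/
theorem two_mul_card_le_of_unique_min {T : Finset σ} {φ : (σ →₀ ℕ) → k}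
    (hφ : (Function.support φ).Finite) {p p' : σ →₀ ℕ} {q q' : σ}
    (hp : φ p ≠ 0) (hmin : ∀ a, φ a ≠ 0 → a ≠ p → p q < a q) (hq : q ∈ T)
    (hp' : φ p' ≠ 0) (hmin' : ∀ a, φ a ≠ 0 → a ≠ p' → p' q' < a q') (hq' : q' ∈ T)
    (hne : p' ≠ p) : 2 * T.card ≤ (Function.support (shiftSum T φ)).ncard + 2 := by
  classical
  have key := card_add_card_le_ncard (finite_support_shiftSum T hφ)
    (s := ↑((T.erase q).image fun i => p + Finsupp.single i 1))
    (t := ↑((T.erase q').image fun i => p' + Finsupp.single i 1)) ?_ ?_ ?_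
  · rw [Set.ncard_coe_finset, Set.ncard_coe_finset, Finset.card_image_of_injective,
      Finset.card_image_of_injective, Finset.card_erase_of_mem hq, Finset.card_erase_of_mem hq']
      at key
    · omega
    all_goals
      intro i j h
      simpa [Finsupp.single_left_inj] using h
  · intro a ha
    obtain ⟨i, hi, rfl⟩ := Finset.mem_image.1 (Finset.mem_coe.1 ha)
    exact shiftSum_ne_zero_of_unique_min hp hmin (Finset.mem_of_mem_erase hi)
      (Finset.ne_of_mem_erase hi)
  · intro a ha
    obtain ⟨i, hi, rfl⟩ := Finset.mem_image.1 (Finset.mem_coe.1 ha)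
    exact shiftSum_ne_zero_of_unique_min hp' hmin' (Finset.mem_of_mem_erase hi)
      (Finset.ne_of_mem_erase hi)
  -- The two families are separated by their `q`-degree: it is `p q` on the first, and at least `p'
  -- q > p q` on the second.
  · intro a ha ha'
    obtain ⟨i, hi, rfl⟩ := Finset.mem_image.1 (Finset.mem_coe.1 ha)
    obtain ⟨j, hj, h⟩ := Finset.mem_image.1 (Finset.mem_coe.1 ha')
    have h1 := DFunLike.congr_fun h q
    have h2 := hmin p' hp' hne
    simp [Finset.ne_of_mem_erase hi] at h1
    omega

/-- The case of the lower bound for the number of monomials in which the top layer is a single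
monomial and the intermediate layers of the product vanish: then the lowest layer of the product
is that of a monomial times a power of the sum of the variables. -/
theorem ncard_layer_of_middle_eq_zero [CharZero k] {T : Finset σ} {φ : (σ →₀ ℕ) → k}
    {q : σ} (hq : q ∈ T) {m : σ →₀ ℕ} (hm : φ m ≠ 0)
    (htop : ∀ a, φ a ≠ 0 → a ≠ m → a q < m q)
    {s : ℕ} (hs : s < m q) (hmin : ∀ a, φ a ≠ 0 → s ≤ a q)
    (hmid : ∀ a, s < a q → a q ≤ m q → shiftSum T φ a = 0) {i₀ : σ} (hi₀ : i₀ ∈ T)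
    (hi₀q : i₀ ≠ q) :
    ∃ U : Finset (σ →₀ ℕ), 2 * T.card ≤ U.card + 3 ∧
      ∀ a ∈ U, a q = s ∧ shiftSum T φ a ≠ 0 := by
  classical
  -- the coefficients of the layers from the top one downwards
  have term : ∀ j : ℕ, j ≤ m q - s → (∀ a : σ →₀ ℕ, a.degree = m.degree → (∀ i ∉ T, a i = m i) →
        a q + j = m q → ∃ N : ℕ, φ a = (-1) ^ j * φ m * N ∧ (N ≠ 0 ↔ ∀ i ∈ T.erase q, m i ≤ a i)) →
      ∀ b : σ →₀ ℕ, b.degree = m.degree + 1 → (∀ i ∉ T, b i = m i) → b q + j = m q →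
        ∃ N : ℕ, shiftSum (T.erase q) φ b = (-1) ^ j * φ m * N ∧
          (N ≠ 0 ↔ ∀ i ∈ T.erase q, m i ≤ b i) := by
    intro j hj IH b hb hbT hbq
    have : ∀ i ∈ T.erase q, ∃ N : ℕ, (if b i = 0 then 0 else φ (b - Finsupp.single i 1)) =
        (-1) ^ j * φ m * N ∧
          (N ≠ 0 ↔ m i < b i ∧ ∀ i ∈ T.erase q, m i ≤ b i) := by
      intro i hi
      split_ifs with h0
      · exact ⟨0, by simp, by simp [h0]⟩
      · obtain ⟨hiq, hiT⟩ := Finset.mem_erase.1 hi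
        obtain ⟨N, hN, hN'⟩ := IH (b - Finsupp.single i 1)
          (by have := Finsupp.degree_sub_single h0; omega)
          (fun l hl => by
            rw [Finsupp.sub_single_apply_of_ne (by rintro rfl; exact hl hiT)]; exact hbT l hl)
          (by rw [Finsupp.sub_single_apply_of_ne hiq.symm]; exact hbq)
        refine ⟨N, hN, hN'.trans ⟨fun h => ⟨?_, fun l hl => ?_⟩, fun h l hl => ?_⟩⟩
        · have := h i hi
          simp at this
          omega
        · exact (h l hl).trans (by simp)
        · by_cases hli : l = i
          · subst hli; simp; omega
          · rw [Finsupp.sub_single_apply_of_ne hli]; exact h.2 l hl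
    choose! N hN hN' using this
    -- The multiplicities are natural numbers, so their sum vanishes only if all of them do: there
    -- is no cancellation within a layer.
    refine ⟨∑ i ∈ T.erase q, N i, ?_, ?_⟩
    · rw [shiftSum, Finset.sum_congr rfl hN, Nat.cast_sum, Finset.mul_sum]
    · rw [Ne, Finset.sum_eq_zero_iff]
      push Not
      constructor
      · rintro ⟨i, hi, h⟩
        exact ((hN' i hi).1 h).2
      · intro h
        obtain ⟨i, hi⟩ := Finsupp.exists_lt_of_degree_lt (show m.degree < b.degree by omega)
        have hiT : i ∈ T.erase q := by
          refine Finset.mem_erase.2 ⟨?_, ?_⟩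
          · rintro rfl; omega
          · by_contra hc; have := hbT i hc; omega
        exact ⟨i, hiT, (hN' i hiT).2 ⟨hi, h⟩⟩
  have layer : ∀ j : ℕ, j ≤ m q - s → ∀ a : σ →₀ ℕ, a.degree = m.degree →
      (∀ i ∉ T, a i = m i) → a q + j = m q →
        ∃ N : ℕ, φ a = (-1) ^ j * φ m * N ∧ (N ≠ 0 ↔ ∀ i ∈ T.erase q, m i ≤ a i) := by
    intro j
    induction j with
    | zero =>
      intro _ a ha haT haq
      by_cases h : a = m
      · exact ⟨1, by simp [h], by simp [h]⟩
      · refine ⟨0, ?_, ?_⟩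
        · by_contra h0
          have := htop a (by simpa using h0) h
          omega
        · simp only [ne_eq, not_true_eq_false, false_iff]
          intro hc
          refine h (Finsupp.eq_of_le_of_degree_le (a := m) (b := a) (fun i => ?_) ha.le).symm
          by_cases hi : i ∈ T.erase q
          · exact hc i hi
          · by_cases hiq : i = q
            · subst hiq; omega
            · exact (haT i (fun hc => hi (Finset.mem_erase.2 ⟨hiq, hc⟩))).ge
    | succ j ih =>
      intro hj a ha haT haq
      obtain ⟨N, hN, hN'⟩ := term j (by omega) (ih (by omega)) (a + Finsupp.single q 1)
        (by simp [ha]) (fun i hi => by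
          rw [Finsupp.add_apply, Finsupp.single_eq_of_ne (by rintro rfl; exact hi hq), add_zero]
          exact haT i hi) (by simp; omega)
      -- A vanishing layer of the product expresses each layer of `φ` as minus the sum of the other
      -- variables times the layer above, divided by `x_q`.
      have h0 := hmid (a + Finsupp.single q 1) (by simp; omega) (by simp; omega)
      rw [shiftSum_add_single _ _ hq, hN] at h0
      refine ⟨N, ?_, hN'.trans (forall₂_congr fun i hi => ?_)⟩
      · rw [pow_succ]; linear_combination h0
      · rw [Finsupp.add_apply, Finsupp.single_eq_of_ne (Finset.ne_of_mem_erase hi), add_zero]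
  have nonzero : ∀ b : σ →₀ ℕ, b.degree = m.degree + 1 → (∀ i ∉ T, b i = m i) → b q = s →
      (∀ i ∈ T.erase q, m i ≤ b i) → shiftSum T φ b ≠ 0 := by
    intro b hb hbT hbq hbm
    obtain ⟨N, hN, hN'⟩ := term (m q - s) le_rfl (layer _ le_rfl) b hb hbT (by omega)
    rw [shiftSum_eq_add _ _ hq, hN]
    have : (if b q = 0 then 0 else φ (b - Finsupp.single q 1)) = 0 := by
      split_ifs with h0
      · rfl
      · by_contra hc
        have := hmin _ hc
        simp at this
        omega
    rw [this, zero_add]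
    have := hN'.2 hbm
    exact mul_ne_zero (mul_ne_zero (pow_ne_zero _ (by simp)) hm) (by exact_mod_cast this)
  obtain ⟨c, hc⟩ : ∃ c, m q = s + c + 1 := ⟨m q - s - 1, by omega⟩
  let μ : σ →₀ ℕ := m - Finsupp.single q (c + 1)
  have hμ : μ + Finsupp.single q (c + 1) = m :=
    tsub_add_cancel_of_le (Finsupp.single_le_iff.2 (by omega))
  have hμq : μ q = s := by simp [μ]; omega
  have hμi : ∀ i, i ≠ q → μ i = m i := fun i hi => by
    rw [← hμ, Finsupp.add_apply, Finsupp.single_eq_of_ne hi, add_zero]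
  have hμd : μ.degree + (c + 1) = m.degree := by
    rw [← hμ, map_add, Finsupp.degree_single]
  have mem : ∀ ν : σ →₀ ℕ, ν.degree = c + 2 → (∀ i ∉ T.erase q, ν i = 0) →
      (μ + ν) q = s ∧ shiftSum T φ (μ + ν) ≠ 0 := by
    intro ν hν hνT
    have h1 : (μ + ν) q = s := by simp [hμq, hνT q]
    refine ⟨h1, nonzero _ (by rw [map_add]; omega) (fun i hi => ?_) h1 fun i hi => ?_⟩
    · rw [Finsupp.add_apply, hνT i (fun h => hi (Finset.mem_of_mem_erase h)),
        hμi i (by rintro rfl; exact hi hq), add_zero]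
    · rw [Finsupp.add_apply, hμi i (Finset.ne_of_mem_erase hi)]; omega
  -- The lowest layer has the same support as `μ` times the `(c + 2)`-nd power of the sum of the
  -- variables other than `x_q`. The monomials `x_i^(c+2)` and `x_{i₀}^(c+1) x_i` of this power
  -- already number `2 |T| - 3`.
  refine ⟨(T.erase q).image (fun i => μ + Finsupp.single i (c + 2)) ∪
    ((T.erase q).erase i₀).image
      (fun i => μ + (Finsupp.single i₀ (c + 1) + Finsupp.single i 1)), ?_, ?_⟩
  · rw [Finset.card_union_of_disjoint, Finset.card_image_of_injective,
      Finset.card_image_of_injective, Finset.card_erase_of_mem (Finset.mem_erase.2 ⟨hi₀q, hi₀⟩),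
      Finset.card_erase_of_mem hq]
    · omega
    · intro i j h
      simpa [Finsupp.single_left_inj] using h
    · intro i j h
      exact (Finsupp.single_left_inj (by omega)).1 (add_left_cancel h)
    · rw [Finset.disjoint_left]
      intro a ha ha'
      obtain ⟨i, hi, rfl⟩ := Finset.mem_image.1 ha
      obtain ⟨j, hj, h⟩ := Finset.mem_image.1 ha'
      have h1 := DFunLike.congr_fun (add_left_cancel h) j
      have hj0 := Finset.ne_of_mem_erase hj
      simp [Finsupp.single_apply, hj0.symm] at h1
      split_ifs at h1; omega
  · intro a ha
    rcases Finset.mem_union.1 ha with ha | ha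
    · obtain ⟨i, hi, rfl⟩ := Finset.mem_image.1 ha
      refine mem _ (by simp) fun l hl => ?_
      exact Finsupp.single_eq_of_ne (by rintro rfl; exact hl hi)
    · obtain ⟨i, hi, rfl⟩ := Finset.mem_image.1 ha
      refine mem _ (by simp) fun l hl => ?_
      rw [Finsupp.add_apply, Finsupp.single_eq_of_ne, Finsupp.single_eq_of_ne, add_zero]
      · rintro rfl; exact hl (Finset.mem_of_mem_erase hi)
      · rintro rfl; exact hl (Finset.mem_erase.2 ⟨hi₀q, hi₀⟩)

/-- A polynomial that is not a monomial, homogeneous in the variables `T`, times the sum of these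
variables has at least `2 |T| - 2` monomials. -/
theorem two_mul_card_le_ncard_support_shiftSum [CharZero k] (T : Finset σ) :
    ∀ φ : (σ →₀ ℕ) → k, (Function.support φ).Finite →
      (∀ a b, φ a ≠ 0 → φ b ≠ 0 → a.degree = b.degree ∧ ∀ i ∉ T, a i = b i) →
      (Function.support φ).Nontrivial →
      2 * T.card ≤ (Function.support (shiftSum T φ)).ncard + 2 := by
  classical
  induction hn : T.card generalizing T with
  | zero => intros; omega
  | succ t ih =>
  intro φ hφ hdeg hnt
  have hfin := finite_support_shiftSum T hφ
  have exists_min : ∀ q, ∃ p, φ p ≠ 0 ∧ ∀ a, φ a ≠ 0 → p q ≤ a q := fun q => by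
    obtain ⟨p, hp, h⟩ := Set.exists_min_image _ (fun a : σ →₀ ℕ => a q) hφ hnt.nonempty
    exact ⟨p, hp, h⟩
  have exists_max : ∀ q, ∃ p, φ p ≠ 0 ∧ ∀ a, φ a ≠ 0 → a q ≤ p q := fun q => by
    obtain ⟨p, hp, h⟩ := Set.exists_max_image _ (fun a : σ →₀ ℕ => a q) hφ hnt.nonempty
    exact ⟨p, hp, h⟩
  rw [← hn]
  -- Either some variable of non-constant degree has at least two monomials in its lowest layer, and
  -- induction on that layer gives all but two of the required monomials, or all these lowest layers
  -- are single monomials.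
  by_cases hcase : ∃ q ∈ T, ∃ p₁ p₂ m, φ p₁ ≠ 0 ∧ φ p₂ ≠ 0 ∧ φ m ≠ 0 ∧ p₁ ≠ p₂ ∧ p₁ q = p₂ q ∧
      p₁ q < m q ∧ ∀ a, φ a ≠ 0 → p₁ q ≤ a q
  · obtain ⟨q, hq, p₁, p₂, m', hp₁, hp₂, hm', hp, hpq, hlt, hmin⟩ := hcase
    obtain ⟨m, hm, hmax⟩ := exists_max q
    have hs : p₁ q < m q := hlt.trans_le (hmax _ hm')
    by_cases hT : (T.erase q).Nonempty
    swap
    · rw [Finset.not_nonempty_iff_eq_empty] at hT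
      have := Finset.card_erase_of_mem hq
      rw [hT, Finset.card_empty] at this
      omega
    -- the lowest layer
    let φ₀ : (σ →₀ ℕ) → k := fun a => if a q = p₁ q then φ a else 0
    have hφ₀ : ∀ {a}, φ₀ a ≠ 0 → a q = p₁ q ∧ φ a ≠ 0 := fun {a} h => by
      by_cases hc : a q = p₁ q
      · exact ⟨hc, by simpa [φ₀, hc] using h⟩
      · simp [φ₀, hc] at h
    have hlow : ∀ {a}, shiftSum (T.erase q) φ₀ a ≠ 0 → a q = p₁ q := fun {a} h => by
      obtain ⟨i, hi, h0, h⟩ := exists_of_shiftSum_ne_zero h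
      rw [← (hφ₀ h).1, Finsupp.sub_single_apply_of_ne (Finset.ne_of_mem_erase hi).symm]
    have heq : ∀ {a : σ →₀ ℕ}, a q = p₁ q → shiftSum T φ a = shiftSum (T.erase q) φ₀ a := by
      intro a ha
      rw [shiftSum_eq_add _ _ hq]
      have : (if a q = 0 then 0 else φ (a - Finsupp.single q 1)) = 0 := by
        split_ifs with h0
        · rfl
        · by_contra hc
          have := hmin _ hc
          simp at this
          omega
      rw [this, zero_add]
      refine Finset.sum_congr rfl fun i hi => ?_
      simp only [φ₀]
      rw [Finsupp.sub_single_apply_of_ne (Finset.ne_of_mem_erase hi).symm, if_pos ha]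
    have hsub : Function.support (shiftSum (T.erase q) φ₀) ⊆
        {a | shiftSum T φ a ≠ 0 ∧ a q = p₁ q} := fun a ha =>
      ⟨by rw [heq (hlow ha)]; exact ha, hlow ha⟩
    have hIH : 2 * (T.erase q).card ≤ (Function.support (shiftSum (T.erase q) φ₀)).ncard + 2 := by
      have hc : (T.erase q).card = t := by rw [Finset.card_erase_of_mem hq]; omega
      rw [hc]
      refine ih _ hc φ₀ (hφ.subset fun a ha => (hφ₀ ha).2) (fun a b ha hb => ?_)
        ⟨p₁, by simpa [φ₀] using hp₁, p₂, by simpa [φ₀, hpq] using hp₂, hp⟩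
      refine ⟨(hdeg a b (hφ₀ ha).2 (hφ₀ hb).2).1, fun i hi => ?_⟩
      by_cases hiq : i = q
      · rw [hiq, (hφ₀ ha).1, (hφ₀ hb).1]
      · exact (hdeg a b (hφ₀ ha).2 (hφ₀ hb).2).2 i fun h => hi (Finset.mem_erase.2 ⟨hiq, h⟩)
    have hcard := Finset.card_erase_of_mem hq
    have htop : ∀ {a}, φ a ≠ 0 → a q = m q → shiftSum T φ (a + Finsupp.single q 1) ≠ 0 := by
      intro a ha haq
      rw [shiftSum_add_single _ _ hq, shiftSum, Finset.sum_eq_zero, add_zero]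
      · exact ha
      · intro i hi
        split_ifs with h0
        · rfl
        · by_contra hc
          have := hmax _ hc
          rw [Finsupp.sub_single_apply_of_ne (Finset.ne_of_mem_erase hi).symm] at this
          simp at this
          omega
    have hle : {a | shiftSum T φ a ≠ 0 ∧ a q = p₁ q}.ncard ≥
        (Function.support (shiftSum (T.erase q) φ₀)).ncard :=
      Set.ncard_le_ncard hsub (hfin.subset fun a ha => ha.1)
    -- two more monomials in higher layers are enough
    have two : ∀ a b, a ≠ b → shiftSum T φ a ≠ 0 → shiftSum T φ b ≠ 0 → p₁ q < a q → p₁ q < b q →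
        2 * T.card ≤ (Function.support (shiftSum T φ)).ncard + 2 := by
      intro a b hab ha hb haq hbq
      have := card_add_card_le_ncard hfin (s := {a | shiftSum T φ a ≠ 0 ∧ a q = p₁ q})
        (t := {a, b}) (fun a ha => ha.1) (by rintro c (rfl | rfl) <;> assumption)
        (by rintro c hc (rfl | rfl) <;> have := hc.2 <;> omega)
      rw [Set.ncard_pair hab] at this
      omega
    by_cases hm2 : ∃ a, φ a ≠ 0 ∧ a q = m q ∧ a ≠ m
    · obtain ⟨a, ha, haq, ham⟩ := hm2
      exact two (a + Finsupp.single q 1) (m + Finsupp.single q 1) (by simpa using ham)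
        (htop ha haq) (htop hm rfl) (by simp; omega) (by simp; omega)
    by_cases hmid : ∃ a, p₁ q < a q ∧ a q ≤ m q ∧ shiftSum T φ a ≠ 0
    · obtain ⟨a, ha, ha', h⟩ := hmid
      refine two a (m + Finsupp.single q 1) (fun h => ?_) h (htop hm rfl) ha (by simp; omega)
      have := DFunLike.congr_fun h q
      simp at this
      omega
    push Not at hm2 hmid
    obtain ⟨i₀, hi₀⟩ := hT
    obtain ⟨U, hU, hUs⟩ := ncard_layer_of_middle_eq_zero hq hm (fun a ha hne => lt_of_le_of_ne
      (hmax a ha) fun h => hne (hm2 a ha h)) hs hmin hmid (Finset.mem_of_mem_erase hi₀)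
      (Finset.ne_of_mem_erase hi₀)
    have := card_add_card_le_ncard hfin (s := ↑U) (t := {m + Finsupp.single q 1})
      (fun a ha => (hUs a ha).2) (by rintro c rfl; exact htop hm rfl) (by
        rintro c hc rfl
        have := (hUs _ hc).1
        simp at this
        omega)
    rw [Set.ncard_coe_finset, Set.ncard_singleton] at this
    omega
  · -- every variable of non-constant degree has a unique monomial of lowest degree
    have uniq : ∀ q ∈ T, ∀ a b, φ a ≠ 0 → φ b ≠ 0 → a q < b q →
        ∃ p, φ p ≠ 0 ∧ ∀ a, φ a ≠ 0 → a ≠ p → p q < a q := by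
      intro q hq a b ha hb hab
      obtain ⟨p, hp, hmin⟩ := exists_min q
      refine ⟨p, hp, fun c hc hcp => lt_of_le_of_ne (hmin c hc) fun h => hcase ?_⟩
      exact ⟨q, hq, p, c, b, hp, hc, hb, hcp.symm, h, (hmin a ha).trans_lt hab, hmin⟩
    have differ : ∀ a b, φ a ≠ 0 → φ b ≠ 0 → a ≠ b → ∃ q ∈ T, a q < b q := by
      intro a b ha hb hab
      by_contra! hc
      refine hab (Finsupp.eq_of_le_of_degree_le (fun i => ?_) (hdeg a b ha hb).1.le).symm
      by_cases hi : i ∈ T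
      · exact hc i hi
      · exact ((hdeg a b ha hb).2 i hi).ge
    obtain ⟨x, hx, y, hy, hxy⟩ := hnt
    obtain ⟨q, hq, hlt⟩ := differ x y hx hy hxy
    obtain ⟨p, hp, hmin⟩ := uniq q hq x y hx hy hlt
    obtain ⟨z, hz, hzp⟩ : ∃ z, φ z ≠ 0 ∧ z ≠ p := by
      by_cases h : x = p
      · exact ⟨y, hy, by rw [← h]; exact hxy.symm⟩
      · exact ⟨x, hx, h⟩
    -- Here `z` lies strictly below `p` in `x_{q'}`-degree, so the minimum for `q'` is different
    -- from `p`.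
    obtain ⟨q', hq', hlt'⟩ := differ z p hz hp hzp
    obtain ⟨p', hp', hmin'⟩ := uniq q' hq' z p hz hp hlt'
    refine two_mul_card_le_of_unique_min hφ hp hmin hq hp' hmin' hq' ?_
    rintro rfl
    exact absurd (hmin' z hz hzp) (by omega)

end ShiftSum

/-! ### Monomial ideals and failure of the weak Lefschetz property. -/

section Togliatti

open MvPolynomial

variable {k : Type*} [Field k] {n : ℕ}

theorem mem_monomialIdeal {S : Finset (Fin (n + 1) →₀ ℕ)} {f : MvPolynomial (Fin (n + 1)) k} :
    f ∈ monomialIdeal k S ↔ ∀ a, coeff a f ≠ 0 → ∃ s ∈ S, s ≤ a := by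
  rw [monomialIdeal, mem_ideal_span_monomial_image]
  simp [mem_support_iff]

theorem monomialIdeal_mono {S T : Finset (Fin (n + 1) →₀ ℕ)} (h : T ⊆ S) :
    monomialIdeal k T ≤ monomialIdeal k S :=
  Ideal.span_mono (Set.image_mono (by exact_mod_cast h))

theorem mem_monomialIdeal_iff_of_isHomogeneous {d : ℕ} {S : Finset (Fin (n + 1) →₀ ℕ)}
    (hS : ∀ a ∈ S, a.degree = d) {f : MvPolynomial (Fin (n + 1)) k} (hf : f.IsHomogeneous d) :
    f ∈ monomialIdeal k S ↔ ∀ a, coeff a f ≠ 0 → a ∈ S := by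
  rw [mem_monomialIdeal]
  refine forall₂_congr fun a ha => ⟨?_, fun h => ⟨a, h, le_rfl⟩⟩
  rintro ⟨s, hs, hsa⟩
  have : a.degree = d := by
    by_contra hc
    exact ha (hf.coeff_eq_zero hc)
  rwa [← Finsupp.eq_of_le_of_degree_le hsa (by rw [this, hS s hs])]

theorem monomial_mem_monomialIdeal {d : ℕ} {S : Finset (Fin (n + 1) →₀ ℕ)}
    (hS : ∀ a ∈ S, a.degree = d) {a : Fin (n + 1) →₀ ℕ} (ha : a.degree = d) :
    monomial a (1 : k) ∈ monomialIdeal k S ↔ a ∈ S := by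
  classical
  rw [mem_monomialIdeal_iff_of_isHomogeneous hS (isHomogeneous_monomial _ ha)]
  simp [coeff_monomial]

theorem coeff_mul_of_mem_monomialIdeal {d : ℕ} {S : Finset (Fin (n + 1) →₀ ℕ)}
    (hS : ∀ a ∈ S, a.degree = d) {s : Fin (n + 1) →₀ ℕ} (hs : s.degree = d)
    (p : MvPolynomial (Fin (n + 1)) k) {f : MvPolynomial (Fin (n + 1)) k}
    (hf : f ∈ monomialIdeal k S) : coeff s (p * f) = coeff 0 p * coeff s f := by
  classical
  rw [coeff_mul, Finset.sum_eq_single (0, s)]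
  · rintro ⟨u, v⟩ huv hne
    rw [Finset.HasAntidiagonal.mem_antidiagonal] at huv
    by_contra hc
    obtain ⟨t, ht, htv⟩ := mem_monomialIdeal.1 hf v (right_ne_zero_of_mul hc)
    simp only at huv
    have hvs : v ≤ s := by rw [← huv]; exact le_add_self
    have := Finsupp.eq_of_le_of_degree_le hvs (by
      rw [hs, ← hS t ht]; exact Finsupp.degree_mono htv)
    subst this
    exact hne (by simpa using huv)
  · intro h
    simp at h

/-- All generators have the same degree, so multiplying an element of the ideal by `p` scales its
coefficients at `S` by the constant term of `p`. Hence the coefficient vectors of any generating set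
span `k^S`. -/
theorem spanFinrank_monomialIdeal {d : ℕ} {S : Finset (Fin (n + 1) →₀ ℕ)}
    (hS : ∀ a ∈ S, a.degree = d) :
    Submodule.spanFinrank (monomialIdeal k S) = S.card := by
  classical
  apply le_antisymm
  · refine (Submodule.spanFinrank_span_le_ncard_of_finite (S.finite_toSet.image _)).trans ?_
    exact (Set.ncard_image_le S.finite_toSet).trans_eq (Set.ncard_coe_finset S)
  · obtain ⟨G, hG, hspan⟩ := Submodule.FG.exists_span_finset_card_eq_spanFinrank
      (IsNoetherian.noetherian (monomialIdeal k S))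
    let π : MvPolynomial (Fin (n + 1)) k →ₗ[k] (S → k) :=
      LinearMap.pi fun s => lcoeff k (s : Fin (n + 1) →₀ ℕ)
    have hπ : ∀ f s, π f s = coeff (s : Fin (n + 1) →₀ ℕ) f := fun f s => rfl
    have key : ∀ f ∈ monomialIdeal k S,
        π f ∈ Submodule.span k (G.image π : Set (S → k)) := by
      intro f hf
      rw [← hspan] at hf
      induction hf using Submodule.span_induction with
      | mem x hx => exact Submodule.subset_span (by simpa using ⟨x, hx, rfl⟩)
      | zero => simp
      | add x y _ _ hx hy => rw [map_add]; exact Submodule.add_mem _ hx hy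
      | smul p x hx h =>
        rw [hspan] at hx
        have : π (p • x) = coeff 0 p • π x := by
          ext s
          rw [hπ, smul_eq_mul, coeff_mul_of_mem_monomialIdeal hS (hS s s.2) p hx]
          rfl
        rw [this]
        exact Submodule.smul_mem _ _ h
    have htop : (⊤ : Submodule k (S → k)) ≤ Submodule.span k (G.image π : Set (S → k)) := by
      rw [← (Pi.basisFun k S).span_eq, Submodule.span_le]
      rintro _ ⟨s, rfl⟩
      have := key (monomial (s : Fin (n + 1) →₀ ℕ) 1)
        ((monomial_mem_monomialIdeal hS (hS s s.2)).2 s.2)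
      convert! this using 1
      ext t
      rw [hπ, coeff_monomial, Pi.basisFun_apply, Pi.single_apply]
      exact if_congr (by rw [Subtype.ext_iff, eq_comm]) rfl rfl
    rw [← hG]
    have h1 := finrank_span_finset_le_card (R := k) (G.image π)
    rw [Set.finrank, top_le_iff.1 htop, finrank_top, Module.finrank_fintype_fun_eq_card,
      Fintype.card_coe] at h1
    exact h1.trans Finset.card_image_le

/-- The powers of `x_i` generate a stationary chain, so `x_i^(N+1) y - x_i^N` lies in the ideal for
some `N` and `y`. It contains the monomial `x_i^N`, which must be divisible by a generator. -/
theorem single_mem_of_isArtinianRing {d : ℕ} {S : Finset (Fin (n + 1) →₀ ℕ)}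
    (hS : ∀ a ∈ S, a.degree = d)
    (h : IsArtinianRing (MvPolynomial (Fin (n + 1)) k ⧸ monomialIdeal k S)) (i : Fin (n + 1)) :
    Finsupp.single i d ∈ S := by
  classical
  obtain ⟨N, y, hy⟩ := IsArtinian.exists_pow_succ_smul_dvd
    (Ideal.Quotient.mk (monomialIdeal k S) (X i))
      (1 : MvPolynomial (Fin (n + 1)) k ⧸ monomialIdeal k S)
  obtain ⟨y, rfl⟩ := Ideal.Quotient.mk_surjective y
  rw [smul_eq_mul, smul_eq_mul, mul_one, ← map_pow, ← map_pow, ← map_mul, Ideal.Quotient.eq,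
    mem_monomialIdeal] at hy
  obtain ⟨s, hs, hsN⟩ := hy (Finsupp.single i N) (by
    rw [coeff_sub, X_pow_eq_monomial, X_pow_eq_monomial, coeff_monomial_mul']
    simp)
  have : s = Finsupp.single i (s i) := by
    ext j
    by_cases hj : j = i
    · subst hj; simp
    · have := hsN j
      rw [Finsupp.single_eq_of_ne hj] at this ⊢
      omega
  have hd := hS s hs
  rw [this, Finsupp.degree_single] at hd
  rwa [← hd, ← this]

/-- The variables are nilpotent, hence integral, in the quotient, which is therefore
finite-dimensional over `k`. -/
theorem isArtinianRing_of_single_mem {d : ℕ} (hd : d ≠ 0) {S : Finset (Fin (n + 1) →₀ ℕ)}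
    (h : ∀ i, Finsupp.single i d ∈ S) :
    IsArtinianRing (MvPolynomial (Fin (n + 1)) k ⧸ monomialIdeal k S) := by
  have hX : ∀ i, IsIntegral k (Ideal.Quotient.mk (monomialIdeal k S) (X i)) := by
    intro i
    refine IsIntegral.of_pow (Nat.pos_of_ne_zero hd) ?_
    have : Ideal.Quotient.mk (monomialIdeal k S) (X i) ^ d = 0 := by
      rw [← map_pow, Ideal.Quotient.eq_zero_iff_mem, X_pow_eq_monomial]
      exact Ideal.subset_span ⟨_, h i, rfl⟩
    rw [this]
    exact isIntegral_zero
  have hint : Algebra.IsIntegral k (MvPolynomial (Fin (n + 1)) k ⧸ monomialIdeal k S) := by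
    refine ⟨fun x => ?_⟩
    obtain ⟨x, rfl⟩ := Ideal.Quotient.mk_surjective x
    induction x using MvPolynomial.induction_on with
    | C a => exact isIntegral_algebraMap (R := k) (x := a)
    | add p q hp hq => rw [map_add]; exact hp.add hq
    | mul_X p i hp => rw [map_mul]; exact hp.mul (hX i)
  have hfin : Module.Finite k (MvPolynomial (Fin (n + 1)) k ⧸ monomialIdeal k S) :=
    Algebra.IsIntegral.finite
  exact IsArtinianRing.of_finite k _

theorem coeff_linearForm_mul (c : Fin (n + 1) → k) (F : MvPolynomial (Fin (n + 1)) k)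
    (a : Fin (n + 1) →₀ ℕ) : coeff a (linearForm c * F) =
      ∑ i, c i * if a i = 0 then 0 else coeff (a - Finsupp.single i 1) F := by
  classical
  rw [linearForm, Finset.sum_mul, coeff_sum]
  refine Finset.sum_congr rfl fun i _ => ?_
  rw [mul_assoc, coeff_C_mul, coeff_X_mul']
  simp [Finsupp.mem_support_iff, ite_not]

theorem isHomogeneous_linearForm (c : Fin (n + 1) → k) : (linearForm c).IsHomogeneous 1 :=
  IsHomogeneous.sum _ _ _ fun i _ => by
    simpa using (isHomogeneous_C (Fin (n + 1)) (c i)).mul (isHomogeneous_X k i)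

theorem isHomogeneous_linearForm_mul {e : ℕ} (c : Fin (n + 1) → k)
    {F : MvPolynomial (Fin (n + 1)) k} (hF : F.IsHomogeneous e) :
    (linearForm c * F).IsHomogeneous (e + 1) := by
  have := (isHomogeneous_linearForm c).mul hF
  rwa [add_comm 1 e] at this

theorem exists_isHomogeneous_coeff_eq {e : ℕ} {φ : (Fin (n + 1) →₀ ℕ) → k}
    (hφ : ∀ a, φ a ≠ 0 → a.degree = e) :
    ∃ F : MvPolynomial (Fin (n + 1)) k, F.IsHomogeneous e ∧ ∀ a, coeff a F = φ a := by
  classical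
  refine ⟨∑ a ∈ Finset.univ.finsuppAntidiag e, monomial a (φ a),
    IsHomogeneous.sum _ _ _ fun a ha => isHomogeneous_monomial _ ?_, fun a => ?_⟩
  · rw [Finset.mem_finsuppAntidiag] at ha
    rw [Finsupp.degree_eq_sum]
    exact ha.1
  · simp only [coeff_sum, coeff_monomial, Finset.sum_ite_eq']
    split_ifs with h
    · rfl
    · by_contra hc
      refine h (Finset.mem_finsuppAntidiag.2 ⟨?_, Finset.subset_univ _⟩)
      rw [← hφ a (Ne.symm hc), Finsupp.degree_eq_sum]

/-- The value of the monomial with exponent `a` at `c`. -/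
def monomialValue (c : Fin (n + 1) → k) (a : Fin (n + 1) →₀ ℕ) : k := ∏ i, c i ^ a i

theorem monomialValue_ne_zero {c : Fin (n + 1) → k} (hc : ∀ i, c i ≠ 0)
    (a : Fin (n + 1) →₀ ℕ) : monomialValue c a ≠ 0 :=
  Finset.prod_ne_zero_iff.2 fun i _ => pow_ne_zero _ (hc i)

theorem monomialValue_sub_single (c : Fin (n + 1) → k) {a : Fin (n + 1) →₀ ℕ} {i : Fin (n + 1)}
    (h : a i ≠ 0) : monomialValue c a = c i * monomialValue c (a - Finsupp.single i 1) := by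
  conv_lhs => rw [← Finsupp.sub_single_add_single h]
  simp only [monomialValue, Finsupp.add_apply, pow_add, Finset.prod_mul_distrib]
  rw [mul_comm, Finset.prod_eq_single i]
  · simp
  · intro j _ hj
    simp [Finsupp.single_eq_of_ne hj]
  · simp

theorem mem_gradedPiece {I : Ideal (MvPolynomial (Fin (n + 1)) k)} {e : ℕ}
    {f : MvPolynomial (Fin (n + 1)) k ⧸ I} :
    f ∈ gradedPiece I e ↔ ∃ F : MvPolynomial (Fin (n + 1)) k, F.IsHomogeneous e ∧
      Ideal.Quotient.mk I F = f :=
  Iff.rfl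

theorem exists_eval_ne_zero_and_ne_zero [Infinite k] {G : MvPolynomial (Fin (n + 1)) k}
    (hG : G ≠ 0) : ∃ c : Fin (n + 1) → k, eval c G ≠ 0 ∧ ∀ i, c i ≠ 0 := by
  have h : G * ∏ i, X i ≠ 0 := mul_ne_zero hG (Finset.prod_ne_zero_iff.2 fun i _ => X_ne_zero i)
  by_contra! hc
  refine h (MvPolynomial.funext fun c => ?_)
  rw [map_mul, map_prod, map_zero]
  by_cases hG : eval c G = 0
  · rw [hG, zero_mul]
  · obtain ⟨i, hi⟩ := hc c hG
    rw [Finset.prod_eq_zero (Finset.mem_univ i) (by simpa using hi), mul_zero]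

/-- If multiplication by the general linear form into degree `d` does not have maximal rank modulo
monomials of degree `d`, then some multiple of `x_0 + ⋯ + x_n` is a combination of these
monomials. -/
theorem exists_shiftSum_support_subset [Infinite k] {e : ℕ} {S : Finset (Fin (n + 1) →₀ ℕ)}
    (hS : ∀ a ∈ S, a.degree = e + 1) (h : FailsWLPInDegree (monomialIdeal k S) e) :
    ∃ φ : (Fin (n + 1) →₀ ℕ) → k, φ ≠ 0 ∧ (∀ a, φ a ≠ 0 → a.degree = e) ∧
      ∀ a, shiftSum Finset.univ φ a ≠ 0 → a ∈ S := by
  obtain ⟨G, hG, h⟩ := h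
  obtain ⟨c, hcG, hc⟩ := exists_eval_ne_zero_and_ne_zero hG
  have h := h c hcG
  rw [MulHasMaximalRank, not_or] at h
  obtain ⟨h, -⟩ := h
  push Not at h
  obtain ⟨f, hf, hLf, hf0⟩ := h
  obtain ⟨F, hF, rfl⟩ := mem_gradedPiece.1 hf
  rw [← map_mul, Ideal.Quotient.eq_zero_iff_mem, mem_monomialIdeal_iff_of_isHomogeneous hS
    (isHomogeneous_linearForm_mul c hF)] at hLf
  -- The substitution `x_i ↦ x_i / c_i` turns the linear form into the sum of the variables and
  -- divides the coefficient at `a` by `c^a`. It does not change supports.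
  refine ⟨fun a => coeff a F * (monomialValue c a)⁻¹, ?_, ?_, ?_⟩
  · intro h0
    refine hf0 ?_
    have : F = 0 := by
      ext a
      have := congrFun h0 a
      simpa [monomialValue_ne_zero hc a] using this
    rw [this, map_zero]
  · intro a ha
    by_contra hne
    exact left_ne_zero_of_mul ha (hF.coeff_eq_zero hne)
  · intro a ha
    refine hLf a ?_
    intro h0
    refine ha ?_
    rw [coeff_linearForm_mul] at h0
    have := congrArg (· * (monomialValue c a)⁻¹) h0
    simp only [zero_mul, Finset.sum_mul] at this
    rw [← this, shiftSum]
    refine Finset.sum_congr rfl fun i _ => ?_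
    split_ifs with hi
    · simp
    · rw [monomialValue_sub_single c hi]
      field_simp [hc i, monomialValue_ne_zero hc]

/-- Rescaling `φ` gives a kernel element for every linear form without zero coefficients.
Surjectivity would pass from the ideal of `T` to the larger ideal of `S`. -/
theorem failsWLPInDegree_of_subset {e : ℕ} {S T : Finset (Fin (n + 1) →₀ ℕ)}
    (hS : ∀ a ∈ S, a.degree = e + 1) (h : FailsWLPInDegree (monomialIdeal k S) e) (hTS : T ⊆ S)
    {φ : (Fin (n + 1) →₀ ℕ) → k} (hφ : φ ≠ 0) (hφe : ∀ a, φ a ≠ 0 → a.degree = e)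
    (hφT : ∀ a, shiftSum Finset.univ φ a ≠ 0 → a ∈ T) :
    FailsWLPInDegree (monomialIdeal k T) e := by
  obtain ⟨G, hG, h⟩ := h
  -- The additional factor restricts to linear forms all of whose coefficients are nonzero.
  refine ⟨G * ∏ i, X i,
    mul_ne_zero hG (Finset.prod_ne_zero_iff.2 fun i _ => X_ne_zero i), fun c hcG => ?_⟩
  rw [map_mul, map_prod] at hcG
  have hc : ∀ i, c i ≠ 0 := fun i => by
    simpa using Finset.prod_ne_zero_iff.1 (right_ne_zero_of_mul hcG) i (Finset.mem_univ i)
  have h := h c (left_ne_zero_of_mul hcG)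
  have hT : ∀ a ∈ T, a.degree = e + 1 := fun a ha => hS a (hTS ha)
  rw [MulHasMaximalRank, not_or] at h ⊢
  constructor
  · intro hinj
    obtain ⟨F, hF, hcoeff⟩ := exists_isHomogeneous_coeff_eq (e := e)
      (φ := fun a => φ a * (monomialValue c a)) (fun a ha => hφe a (left_ne_zero_of_mul ha))
    have hmem : linearForm c * F ∈ monomialIdeal k T := by
      rw [mem_monomialIdeal_iff_of_isHomogeneous hT (isHomogeneous_linearForm_mul c hF)]
      intro a ha
      refine hφT a fun h0 => ha ?_
      rw [coeff_linearForm_mul]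
      rw [shiftSum] at h0
      refine Eq.trans ?_ ((congrArg (· * monomialValue c a) h0).trans (zero_mul _))
      simp only [Finset.sum_mul]
      refine Finset.sum_congr rfl fun i _ => ?_
      split_ifs with hi
      · simp
      · rw [hcoeff, monomialValue_sub_single c hi]
        ring
    have h0 := hinj _ (mem_gradedPiece.2 ⟨F, hF, rfl⟩)
      (by rw [← map_mul]; exact Ideal.Quotient.eq_zero_iff_mem.2 hmem)
    -- The ideal is generated in degree `e + 1`, so a nonzero form of degree `e` cannot lie in it.
    rw [Ideal.Quotient.eq_zero_iff_mem, mem_monomialIdeal] at h0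
    refine hφ (funext fun a => ?_)
    by_contra ha
    obtain ⟨t, ht, hta⟩ := h0 a (by
      rw [hcoeff]; exact mul_ne_zero ha (monomialValue_ne_zero hc a))
    have := Finsupp.degree_mono hta
    rw [hT t ht, hφe a ha] at this
    omega
  · intro hsurj
    refine h.2 fun g hg => ?_
    obtain ⟨g', hg', rfl⟩ := mem_gradedPiece.1 hg
    obtain ⟨f, hf, hfg⟩ := hsurj _ (mem_gradedPiece.2 ⟨g', hg', rfl⟩)
    obtain ⟨f', hf', rfl⟩ := mem_gradedPiece.1 hf
    refine ⟨_, mem_gradedPiece.2 ⟨f', hf', rfl⟩, ?_⟩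
    rw [← map_mul, Ideal.Quotient.eq] at hfg ⊢
    exact monomialIdeal_mono hTS hfg

/-- What the proof uses of a minimal monomial Togliatti system. -/
theorem IsMinimalMonomialTogliattiSystem.exists_exponents [Infinite k] {d : ℕ} (hd : d ≠ 0)
    {I : Ideal (MvPolynomial (Fin (n + 1)) k)} (hI : IsMinimalMonomialTogliattiSystem n d I) :
    ∃ S : Finset (Fin (n + 1) →₀ ℕ), I = monomialIdeal k S ∧ S.card = Submodule.spanFinrank I ∧
      (∀ a ∈ S, a.degree = d) ∧ (∀ i, Finsupp.single i d ∈ S) ∧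
      (∃ φ : (Fin (n + 1) →₀ ℕ) → k, φ ≠ 0 ∧ (∀ a, φ a ≠ 0 → a.degree + 1 = d) ∧
        ∀ a, shiftSum Finset.univ φ a ≠ 0 → a ∈ S) ∧
      ∀ φ : (Fin (n + 1) →₀ ℕ) → k, φ ≠ 0 → (∀ a, φ a ≠ 0 → a.degree + 1 = d) →
        (∀ a, shiftSum Finset.univ φ a ≠ 0 → a ∈ S) →
          ∀ a ∈ S, (∃ i, a = Finsupp.single i d) ∨ shiftSum Finset.univ φ a ≠ 0 := by
  classical
  obtain ⟨⟨hart, ⟨S', hS', hspan, hcard⟩, hfail⟩, S, hS, rfl, hmin⟩ := hI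
  obtain ⟨e, rfl⟩ : ∃ e, d = e + 1 := ⟨d - 1, by omega⟩
  rw [Nat.add_sub_cancel] at hfail
  have hdeg : ∀ a : Fin (n + 1) →₀ ℕ, a.degree + 1 = e + 1 ↔ a.degree = e := by intro a; omega
  simp only [hdeg]
  have hpow := single_mem_of_isArtinianRing hS hart
  refine ⟨S, rfl, (spanFinrank_monomialIdeal hS).symm, hS, hpow,
    exists_shiftSum_support_subset hS hfail, ?_⟩
  -- A generator that is neither a power nor a monomial of the product could be erased: `φ` would
  -- still witness the failure of injectivity.
  intro φ hφ hφe hφS a ha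
  by_contra! hc
  have hTS : S.erase a ⊆ S := Finset.erase_subset _ _
  refine hmin (S.erase a) (Finset.erase_ssubset ha)
    ⟨isArtinianRing_of_single_mem (Nat.succ_ne_zero e) fun i => ?_, ?_, ?_⟩
  · exact Finset.mem_erase.2 ⟨(hc.1 i).symm, hpow i⟩
  · refine ⟨(S.erase a).image fun a => monomial a (1 : k), ?_, ?_, ?_⟩
    · intro F hF
      obtain ⟨b, hb, rfl⟩ := Finset.mem_image.1 hF
      exact isHomogeneous_monomial _ (hS b (hTS hb))
    · rw [monomialIdeal, Finset.coe_image]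
    -- The bound on the number of generators is known for some generating set `S'`; it applies to
    -- `S` because `S` has the minimal number of generators.
    · refine Finset.card_image_le.trans ((Finset.card_le_card hTS).trans (le_trans ?_ hcard))
      rw [← spanFinrank_monomialIdeal (k := k) hS, hspan]
      exact (Submodule.spanFinrank_span_le_ncard_of_finite S'.finite_toSet).trans_eq
        (Set.ncard_coe_finset S')
  · refine failsWLPInDegree_of_subset hS hfail hTS hφ hφe fun b hb => ?_
    refine Finset.mem_erase.2 ⟨?_, hφS b hb⟩
    rintro rfl
    exact hb hc.2

end Togliatti

/-! ### An upper bound for the Krull dimension. -/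

section KrullDimension

open MvPolynomial

/-- By incomparability, contraction of primes along an integral homomorphism is strictly monotone.
-/
theorem ringKrullDim_le_of_isIntegral_of_injective {R B : Type*} [CommRing R] [CommRing B]
    (g : R →+* B) (hg : g.IsIntegral) : ringKrullDim B ≤ ringKrullDim R := by
  let := g.toAlgebra
  have : Algebra.IsIntegral R B := ⟨hg⟩
  refine Order.krullDim_le_of_strictMono (PrimeSpectrum.comap g) fun p q hpq => ?_
  have : p.asIdeal < q.asIdeal := hpq
  exact Ideal.IsIntegral.comap_lt_comap (R := R) this

/-- An algebra of finite type that embeds in a polynomial ring in `m` variables has Krull dimension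
at most `m`. -/
theorem ringKrullDim_le_of_injective_mvPolynomial {k B : Type*} [Field k] [CommRing B]
    [Algebra k B] [Algebra.FiniteType k B] {m : ℕ} (f : B →ₐ[k] MvPolynomial (Fin m) k)
    (hf : Function.Injective f) : ringKrullDim B ≤ m := by
  have : Nontrivial B := f.toRingHom.domain_nontrivial
  -- Noether normalization: `B` is integral over a polynomial ring in `s` variables, and `s ≤ m` by
  -- comparing transcendence degrees.
  obtain ⟨s, g, hg, hint⟩ := exists_integral_inj_algHom_of_fg k B
  refine (ringKrullDim_le_of_isIntegral_of_injective g.toRingHom hint).trans ?_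
  have h1 := trdeg_le_of_injective (f.comp g) (by simpa using hf.comp hg)
  rw [MvPolynomial.trdeg_of_isDomain, MvPolynomial.trdeg_of_isDomain] at h1
  have h2 : s ≤ m := by simpa using h1
  rw [MvPolynomial.ringKrullDim_of_isNoetherianRing, ringKrullDim_eq_zero_of_field]
  simpa using h2

end KrullDimension

/-! ### The toric ideal and its tangent space at a vertex. -/

section TangentSpace

open MvPolynomial

variable {k : Type*} [Field k] {n : ℕ} {A : Finset (Fin (n + 1) →₀ ℕ)}

/-- The exponent of the monomial `∏ (x^a)^{s_a}`. -/
noncomputable def totalExponent (A : Finset (Fin (n + 1) →₀ ℕ)) : (A →₀ ℕ) →+ (Fin (n + 1) →₀ ℕ) :=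
  Finsupp.liftAddHom fun a => (multiplesHom _) (a : Fin (n + 1) →₀ ℕ)

@[simp]
theorem totalExponent_single (a : A) (N : ℕ) :
    totalExponent A (Finsupp.single a N) = N • (a : Fin (n + 1) →₀ ℕ) := by
  simp [totalExponent]

theorem totalExponent_eq_sum (s : A →₀ ℕ) :
    totalExponent A s = ∑ a, s a • (a : Fin (n + 1) →₀ ℕ) := by
  simp [totalExponent, Finsupp.sum_fintype]

/-- The only way to write `N v + b` as a sum of elements of `A` is the obvious one, i.e. `b - v` is
indecomposable in the monoid generated by the differences `a - v`, `a ∈ A`. -/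
def IsIndecomposableAt (v b : A) : Prop :=
  ∀ (N : ℕ) (s : A →₀ ℕ), totalExponent A s = N • (v : Fin (n + 1) →₀ ℕ) + b →
    s = Finsupp.single v N + Finsupp.single b 1

/-- Over an infinite field a polynomial vanishing at all points is zero, so the ideal of the cone is
the toric ideal, the kernel of `y_a ↦ x^a`. -/
theorem mem_vanishingIdeal_range_monomialMap [Infinite k] {f : MvPolynomial A k} :
    f ∈ vanishingIdeal k (Set.range (monomialMap k A)) ↔
      aeval (fun a : A => monomial (a : Fin (n + 1) →₀ ℕ) (1 : k)) f = 0 := by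
  rw [mem_vanishingIdeal_iff]
  have key : ∀ x : Fin (n + 1) → k, aeval (monomialMap k A x) f =
      eval x (aeval (fun a : A => monomial (a : Fin (n + 1) →₀ ℕ) (1 : k)) f) := by
    intro x
    rw [← coe_aeval_eq_eval, RingHom.coe_coe, ← AlgHom.comp_apply, comp_aeval]
    congr 2
    funext a
    simp [monomialMap, aeval_monomial, Finsupp.prod_fintype]
  constructor
  · intro h
    refine MvPolynomial.funext fun x => ?_
    rw [← key, map_zero]
    exact h _ ⟨x, rfl⟩
  · rintro h _ ⟨x, rfl⟩
    rw [key, h, map_zero]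

theorem aeval_monomial_eq_monomial_totalExponent (s : A →₀ ℕ) (c : k) :
    aeval (fun a : A => monomial (a : Fin (n + 1) →₀ ℕ) (1 : k)) (monomial s c) =
      monomial (totalExponent A s) c := by
  rw [aeval_monomial, totalExponent_eq_sum, Finsupp.prod_fintype _ _ (by simp)]
  simp only [monomial_pow, one_pow]
  rw [← MvPolynomial.monomial_sum_one, algebraMap_eq, C_mul_monomial, mul_one]

/-- Under `y_a ↦ x^a` the term with exponent `s` can only cancel against terms with the same total
exponent, and here there are no others. -/
theorem coeff_eq_zero_of_mem_vanishingIdeal [Infinite k] {f : MvPolynomial A k}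
    (hf : f ∈ vanishingIdeal k (Set.range (monomialMap k A))) {s : A →₀ ℕ}
    (hs : ∀ t, totalExponent A t = totalExponent A s → t = s) : coeff s f = 0 := by
  classical
  rw [mem_vanishingIdeal_range_monomialMap] at hf
  have h := congrArg (coeff (totalExponent A s)) hf
  rw [f.as_sum, map_sum, coeff_sum] at h
  simp only [aeval_monomial_eq_monomial_totalExponent, coeff_monomial, coeff_zero] at h
  rw [Finset.sum_eq_single s] at h
  · simpa using h
  · intro t _ hts
    rw [if_neg fun hc => hts (hs t hc)]
  · intro h
    simpa using h

theorem ringKrullDim_quotient_vanishingIdeal_le [Infinite k] (A : Finset (Fin (n + 1) →₀ ℕ)) :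
    ringKrullDim (MvPolynomial A k ⧸ vanishingIdeal k (Set.range (monomialMap k A))) ≤
      (n + 1 : ℕ) := by
  let θ : MvPolynomial A k →ₐ[k] MvPolynomial (Fin (n + 1)) k :=
    aeval (fun a : A => monomial (a : Fin (n + 1) →₀ ℕ) (1 : k))
  refine ringKrullDim_le_of_injective_mvPolynomial (k := k)
    (Ideal.Quotient.liftₐ _ θ fun f hf => mem_vanishingIdeal_range_monomialMap.1 hf) ?_
  rw [injective_iff_map_eq_zero]
  intro x hx
  obtain ⟨f, rfl⟩ := Ideal.Quotient.mk_surjective x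
  exact Ideal.Quotient.eq_zero_iff_mem.2 (mem_vanishingIdeal_range_monomialMap.2 hx)

/-- At the coordinate point `e_v` only the pure powers of `y_v` do not vanish. -/
theorem eval_single_eq_zero {ι : Type*} [DecidableEq ι] (v : ι) {f : MvPolynomial ι k}
    (h : ∀ N, coeff (Finsupp.single v N) f = 0) : eval (Pi.single v 1) f = 0 := by
  rw [eval_eq]
  refine Finset.sum_eq_zero fun s hs => ?_
  by_contra hc
  have hprod := Finset.prod_ne_zero_iff.1 (right_ne_zero_of_mul hc)
  have : s = Finsupp.single v (s v) := by
    ext i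
    by_cases hi : i = v
    · subst hi; simp
    · rw [Finsupp.single_eq_of_ne hi]
      by_contra hsi
      have := hprod i (Finsupp.mem_support_iff.2 hsi)
      rw [Pi.single_eq_of_ne hi, zero_pow hsi] at this
      exact this rfl
  rw [mem_support_iff, this] at hs
  exact hs (h _)

theorem coeff_pderiv_single {ι : Type*} (f : MvPolynomial ι k) (b : ι) (s : ι →₀ ℕ) :
    coeff s (pderiv b f) = coeff (s + Finsupp.single b 1) f * (s b + 1) := by
  classical
  induction f using MvPolynomial.induction_on' with
  | monomial t c =>
    rw [pderiv_monomial, coeff_monomial, coeff_monomial]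
    by_cases h : t = s + Finsupp.single b 1
    · subst h; simp
    · rw [if_neg h, zero_mul]
      split_ifs with h'
      · by_cases hb : t b = 0
        · simp [hb]
        · refine absurd ?_ h
          rw [← h', Finsupp.sub_single_add_single hb]
      · rfl
  | add p q hp hq => simp only [map_add, coeff_add, hp, hq, add_mul]

open Classical in
/-- If `X` is smooth at the point corresponding to a vertex `v` of the polytope, then at most
`n + 1` elements of `A` are indecomposable at `v`. -/
theorem IsSmoothProjectiveVariety.card_le [Infinite k]
    (h : IsSmoothProjectiveVariety (vanishingIdeal k (Set.range (monomialMap k A)))) {v : A}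
    (hv : ∀ (N : ℕ) (s : A →₀ ℕ), totalExponent A s = N • (v : Fin (n + 1) →₀ ℕ) →
      s = Finsupp.single v N) {B : Finset A} (hB : ∀ b ∈ B, IsIndecomposableAt v b) :
    B.card ≤ n + 1 := by
  set J := vanishingIdeal k (Set.range (monomialMap k A)) with hJ
  -- The coordinate point at `v` lies on the cone because no power of `y_v` occurs in any element of
  -- `J`.
  have hp : (Pi.single v 1 : A → k) ∈ zeroLocus k J := by
    intro f hf
    rw [aeval_eq_eval]
    refine eval_single_eq_zero v fun N => coeff_eq_zero_of_mem_vanishingIdeal hf fun t ht => ?_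
    exact hv N t (by simpa using ht)
  have hdim := h _ hp (by simp)
  have hle := hdim.le.trans (ringKrullDim_quotient_vanishingIdeal_le (k := k) A)
  have hle' : Module.finrank k (zariskiTangentSpace J (Pi.single v 1)) ≤ n + 1 := by
    exact_mod_cast hle
  refine le_trans ?_ hle'
  -- The derivative along `y_b` at this point only involves the coefficients of `y_v^N y_b`, which
  -- vanish by indecomposability.
  have hmem : ∀ b ∈ B, (Pi.single b 1 : A → k) ∈ zariskiTangentSpace J (Pi.single v 1) := by
    intro b hb f hf
    rw [Finset.sum_eq_single b]
    · rw [eval_single_eq_zero v, zero_mul]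
      intro N
      rw [coeff_pderiv_single, coeff_eq_zero_of_mem_vanishingIdeal hf, zero_mul]
      intro t ht
      exact hB b hb N t (by simpa using ht)
    · intro c _ hc
      rw [Pi.single_eq_of_ne hc, mul_zero]
    · simp
  have hli : LinearIndependent k fun b : B =>
      (⟨Pi.single (b : A) 1, hmem b b.2⟩ : zariskiTangentSpace J (Pi.single v 1)) := by
    refine LinearIndependent.of_comp (zariskiTangentSpace J (Pi.single v 1)).subtype ?_
    have := (Pi.basisFun k A).linearIndependent.comp (fun b : B => (b : A)) Subtype.val_injective
    convert! this using 1
    ext b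
    simp [Pi.basisFun_apply]
  simpa using hli.fintype_card_le_finrank

end TangentSpace

/-! ### Indecomposable elements at a vertex. -/

section Indecomposable

variable {n d : ℕ} {A : Finset (Fin (n + 1) →₀ ℕ)}

theorem totalExponent_apply (s : A →₀ ℕ) (m : Fin (n + 1)) :
    totalExponent A s m = ∑ a, s a * (a : Fin (n + 1) →₀ ℕ) m := by
  simp [totalExponent_eq_sum, Finsupp.finsetSum_apply]

theorem degree_totalExponent (hA : ∀ a ∈ A, a.degree = d) (s : A →₀ ℕ) :
    (totalExponent A s).degree = s.degree * d := by
  rw [totalExponent_eq_sum, map_sum, Finsupp.degree_eq_sum, Finset.sum_mul]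
  exact Finset.sum_congr rfl fun a _ => by rw [map_nsmul, hA a a.2, smul_eq_mul]

theorem le_totalExponent_apply (s : A →₀ ℕ) {a : A} (ha : s a ≠ 0) (m : Fin (n + 1)) :
    (a : Fin (n + 1) →₀ ℕ) m ≤ totalExponent A s m := by
  rw [totalExponent_apply]
  exact (Nat.le_mul_of_pos_left _ (Nat.pos_of_ne_zero ha)).trans
    (Finset.single_le_sum (f := fun a : A => s a * (a : Fin (n + 1) →₀ ℕ) m)
      (fun _ _ => Nat.zero_le _) (Finset.mem_univ a))

theorem degree_le_totalExponent_apply (s : A →₀ ℕ) {m : Fin (n + 1)}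
    (h : ∀ a, s a ≠ 0 → 1 ≤ (a : Fin (n + 1) →₀ ℕ) m) : s.degree ≤ totalExponent A s m := by
  rw [totalExponent_apply, Finsupp.degree_eq_sum]
  refine Finset.sum_le_sum fun a _ => ?_
  by_cases ha : s a = 0
  · simp [ha]
  · exact Nat.le_mul_of_pos_right _ (h a ha)

theorem totalExponent_apply_le_degree (s : A →₀ ℕ) {m : Fin (n + 1)}
    (h : ∀ a, s a ≠ 0 → (a : Fin (n + 1) →₀ ℕ) m ≤ 1) : totalExponent A s m ≤ s.degree := by
  rw [totalExponent_apply, Finsupp.degree_eq_sum]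
  refine Finset.sum_le_sum fun a _ => ?_
  by_cases ha : s a = 0
  · simp [ha]
  · exact (Nat.mul_le_mul_left _ (h a ha)).trans_eq (mul_one _)

/-- `v` is a vertex of the convex hull of `A`, as witnessed by a linear functional with
nonnegative coefficients. -/
def IsVertex (A : Finset (Fin (n + 1) →₀ ℕ)) (v : A) : Prop :=
  ∃ ω : (Fin (n + 1) →₀ ℕ) →+ ℕ, ∀ a : A, a ≠ v → ω a < ω v

theorem map_totalExponent (ω : (Fin (n + 1) →₀ ℕ) →+ ℕ) (s : A →₀ ℕ) :
    ω (totalExponent A s) = ∑ a, s a * ω a := by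
  simp [totalExponent_eq_sum]

/-- By degree there are exactly `N` summands, and `ω` attains its maximum over `A` only at `v`, so a
total of `N ω(v)` forces every summand to be `v`. -/
theorem IsVertex.eq_single (hA : ∀ a ∈ A, a.degree = d) (hd : 0 < d) {v : A} (hv : IsVertex A v)
    {N : ℕ} {s : A →₀ ℕ} (hs : totalExponent A s = N • (v : Fin (n + 1) →₀ ℕ)) :
    s = Finsupp.single v N := by
  obtain ⟨ω, hω⟩ := hv
  have h1 : s.degree = N := by
    have := degree_totalExponent hA s
    rw [hs, map_nsmul, hA v v.2, smul_eq_mul] at this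
    exact (Nat.eq_of_mul_eq_mul_right hd this).symm
  have h2 : ∑ a, s a * ω a = ∑ a, s a * ω v := by
    rw [← map_totalExponent, hs, map_nsmul, ← Finset.sum_mul, ← Finsupp.degree_eq_sum, h1,
      smul_eq_mul]
  have h3 : ∀ a, a ≠ v → s a = 0 := by
    intro a ha
    have := (Finset.sum_eq_sum_iff_of_le (fun a _ => Nat.mul_le_mul_left (s a) (by
      by_cases h : a = v
      · rw [h]
      · exact (hω a h).le))).1 h2 a (Finset.mem_univ a)
    rcases Nat.eq_zero_or_pos (s a) with h | h
    · exact h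
    · exact absurd (Nat.eq_of_mul_eq_mul_left h this) (hω a ha).ne
  ext a
  by_cases ha : a = v
  · subst ha
    rw [Finsupp.single_eq_same, ← h1, Finsupp.degree_eq_sum,
      Finset.sum_eq_single a (fun b _ hb => h3 b hb) (by simp)]
  · rw [Finsupp.single_eq_of_ne ha, h3 a ha]

theorem degree_eq_of_totalExponent_eq (hA : ∀ a ∈ A, a.degree = d) (hd : 0 < d) {v b : A} {N : ℕ}
    {s : A →₀ ℕ} (hs : totalExponent A s = N • (v : Fin (n + 1) →₀ ℕ) + b) : s.degree = N + 1 := by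
  have := degree_totalExponent hA s
  rw [hs, map_add, map_nsmul, hA v v.2, hA b b.2, smul_eq_mul] at this
  refine (Nat.eq_of_mul_eq_mul_right hd ?_).symm
  linarith

theorem exists_eq_single_add (s : A →₀ ℕ) {c : A} (hc : s c ≠ 0) :
    ∃ r : A →₀ ℕ, s = r + Finsupp.single c 1 ∧ totalExponent A s = totalExponent A r + c ∧
      s.degree = r.degree + 1 ∧ ∀ a, r a ≠ 0 → s a ≠ 0 := by
  refine ⟨s - Finsupp.single c 1, (Finsupp.sub_single_add_single hc).symm, ?_,
    (Finsupp.degree_sub_single hc).symm, fun a ha h => ha (by simp [h])⟩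
  conv_lhs => rw [← Finsupp.sub_single_add_single hc, map_add, totalExponent_single, one_smul]

/-- It suffices to check that `b` occurs in every representation. -/
theorem IsVertex.isIndecomposableAt (hA : ∀ a ∈ A, a.degree = d) (hd : 0 < d) {v b : A}
    (hv : IsVertex A v) (h : ∀ (N : ℕ) (s : A →₀ ℕ), totalExponent A s =
      N • (v : Fin (n + 1) →₀ ℕ) + b → s.degree = N + 1 → s b ≠ 0) : IsIndecomposableAt v b := by
  intro N s hs
  obtain ⟨r, hr, hr', -⟩ :=
    exists_eq_single_add s (h N s hs (degree_eq_of_totalExponent_eq hA hd hs))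
  rw [hr, hv.eq_single hA hd (add_right_cancel (hr'.symm.trans hs))]

theorem IsVertex.isIndecomposableAt_self (hA : ∀ a ∈ A, a.degree = d) (hd : 0 < d) {v : A}
    (hv : IsVertex A v) : IsIndecomposableAt v v := by
  intro N s hs
  rw [← Finsupp.single_add]
  exact hv.eq_single hA hd (hs.trans (succ_nsmul _ _).symm)

/-- The exponent `a` as a vector over `ℚ`. -/
def exponentVector (a : Fin (n + 1) →₀ ℕ) : Fin (n + 1) → ℚ := fun i => a i

theorem exponentVector_totalExponent (s : A →₀ ℕ) :
    exponentVector (totalExponent A s) =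
      ∑ a, (s a : ℚ) • exponentVector (a : Fin (n + 1) →₀ ℕ) := by
  ext i
  simp [exponentVector, totalExponent_apply]

/-- Induction on the distance `ω v - ω b`. It is additive over a representation of `N v + b` and
positive away from `v`, so in a nontrivial representation each summand other than `v` is closer to
`v` than `b` is. -/
theorem IsVertex.exponentVector_mem_span (hA : ∀ a ∈ A, a.degree = d) (hd : 0 < d) {v : A}
    (hv : IsVertex A v) (b : A) : exponentVector (b : Fin (n + 1) →₀ ℕ) ∈
      Submodule.span ℚ ((fun a : A => exponentVector (a : Fin (n + 1) →₀ ℕ)) ''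
        {a | IsIndecomposableAt v a}) := by
  have hself := hv.isIndecomposableAt_self hA hd
  obtain ⟨ω, hω⟩ := id hv
  induction hm : ω v - ω b using Nat.strong_induction_on generalizing b with
  | _ m ih =>
  by_cases hb : IsIndecomposableAt v b
  · exact Submodule.subset_span ⟨b, hb, rfl⟩
  have hbv : b ≠ v := by rintro rfl; exact hb hself
  have hlt := hω b hbv
  rw [IsIndecomposableAt] at hb
  push Not at hb
  obtain ⟨N, s, hs, hne⟩ := hb
  have hdeg := degree_eq_of_totalExponent_eq hA hd hs
  have hωs : ∑ a, s a * ω a = N * ω v + ω b := by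
    rw [← map_totalExponent, hs, map_add, map_nsmul, smul_eq_mul]
  have hsum : ∑ a, s a * (ω v - ω a) = ω v - ω b := by
    have : ∑ a, s a * (ω v - ω a) + ∑ a, s a * ω a = (N + 1) * ω v := by
      rw [← Finset.sum_add_distrib, ← hdeg, Finsupp.degree_eq_sum, Finset.sum_mul]
      refine Finset.sum_congr rfl fun a _ => ?_
      rw [← mul_add, Nat.sub_add_cancel]
      by_cases h : a = v
      · rw [h]
      · exact (hω a h).le
    rw [hωs] at this
    have h' : (N + 1) * ω v = N * ω v + ω v := by ring
    omega
  -- every summand is `v` or has a smaller distance from `v`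
  have hmem : ∀ a, s a ≠ 0 → exponentVector (a : Fin (n + 1) →₀ ℕ) ∈
      Submodule.span ℚ ((fun a : A => exponentVector (a : Fin (n + 1) →₀ ℕ)) ''
        {a | IsIndecomposableAt v a}) := by
    intro a ha
    by_cases hav : a = v
    · rw [hav]; exact Submodule.subset_span ⟨v, hself, rfl⟩
    refine ih _ ?_ a rfl
    rw [← hm, ← hsum]
    by_contra hle
    -- otherwise `a` is the only summand different from `v`
    obtain ⟨r, hr, hr', hrdeg, -⟩ := exists_eq_single_add s ha
    have hr0 : ∀ c, c ≠ v → r c = 0 := by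
      intro c hc
      by_contra hrc
      have h1 : ∑ c, s c * (ω v - ω c) = ∑ c, r c * (ω v - ω c) + (ω v - ω a) := by
        rw [hr]
        simp only [Finsupp.add_apply, add_mul, Finset.sum_add_distrib]
        congr 1
        rw [Finset.sum_eq_single a (fun c _ hc => by simp [Finsupp.single_eq_of_ne hc]) (by simp)]
        simp
      have h2 : 0 < r c * (ω v - ω c) :=
        Nat.mul_pos (Nat.pos_of_ne_zero hrc) (Nat.sub_pos_of_lt (hω c hc))
      have h3 : r c * (ω v - ω c) ≤ _ := Finset.single_le_sum (f := fun c => r c * (ω v - ω c))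
        (fun _ _ => Nat.zero_le _) (Finset.mem_univ c)
      omega
    have hrN : r = Finsupp.single v N := by
      ext c
      by_cases hc : c = v
      · subst hc
        rw [Finsupp.single_eq_same]
        have : r.degree = r c := by
          rw [Finsupp.degree_eq_sum,
            Finset.sum_eq_single c (fun b _ hb => hr0 b hb) (by simp)]
        omega
      · rw [Finsupp.single_eq_of_ne hc, hr0 c hc]
    rw [hrN, totalExponent_single, hs] at hr'
    have hba : b = a := Subtype.ext (add_left_cancel hr')
    exact hne (by rw [hr, hrN, hba])
  have h1 := exponentVector_totalExponent s
  rw [hs] at h1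
  have h2 : exponentVector (b : Fin (n + 1) →₀ ℕ) =
      ∑ a, (s a : ℚ) • exponentVector (a : Fin (n + 1) →₀ ℕ) -
        (N : ℚ) • exponentVector (v : Fin (n + 1) →₀ ℕ) := by
    rw [← h1]
    ext i
    simp [exponentVector]
  rw [h2]
  refine Submodule.sub_mem _ (Submodule.sum_mem _ fun a _ => ?_)
    (Submodule.smul_mem _ _ (Submodule.subset_span ⟨v, hself, rfl⟩))
  by_cases ha : s a = 0
  · simp [ha]
  · exact Submodule.smul_mem _ _ (hmem a ha)

open Classical in
/-- If at most `n + 1` elements of `A` are indecomposable at `v`, then at most three of them lie on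
a two-dimensional coordinate face. -/
theorem IsVertex.card_le_three (hA : ∀ a ∈ A, a.degree = d) (hd : 0 < d) {v : A}
    (hv : IsVertex A v)
    (hspan : Submodule.span ℚ (exponentVector '' (A : Set (Fin (n + 1) →₀ ℕ))) = ⊤)
    (hcard : ∀ B : Finset A, (∀ b ∈ B, IsIndecomposableAt v b) → B.card ≤ n + 1)
    (i j l : Fin (n + 1)) {B : Finset A} (hB : ∀ b ∈ B, IsIndecomposableAt v b)
    (hBface : ∀ b ∈ B, ∀ m, m ≠ i → m ≠ j → m ≠ l → (b : Fin (n + 1) →₀ ℕ) m = 0) :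
    B.card ≤ 3 := by
  let C : Finset A := Finset.univ.filter (IsIndecomposableAt v)
  have hC : C.card ≤ n + 1 := hcard C fun b hb => (Finset.mem_filter.1 hb).2
  let f : C → Fin (n + 1) → ℚ := fun c => exponentVector (c : A)
  have htop : ⊤ ≤ Submodule.span ℚ (Set.range f) := by
    rw [← hspan, Submodule.span_le]
    rintro _ ⟨a, ha, rfl⟩
    refine Submodule.span_mono ?_ (hv.exponentVector_mem_span hA hd ⟨a, ha⟩)
    rintro _ ⟨b, hb, rfl⟩
    exact ⟨⟨b, Finset.mem_filter.2 ⟨Finset.mem_univ _, hb⟩⟩, rfl⟩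
  -- At most `n + 1` vectors spanning a space of dimension `n + 1` form a basis.
  have hli : LinearIndependent ℚ f := by
    refine linearIndependent_of_top_le_span_of_card_eq_finrank htop (le_antisymm ?_ ?_)
    · simpa using hC
    · have := finrank_range_le_card (R := ℚ) f
      rwa [Set.finrank, top_le_iff.1 htop, finrank_top] at this
  have hBC : ∀ b ∈ B, b ∈ C := fun b hb => Finset.mem_filter.2 ⟨Finset.mem_univ _, hB b hb⟩
  have hliB : LinearIndependent ℚ fun b : B => f ⟨b, hBC b b.2⟩ :=
    hli.comp (fun b : B => (⟨b, hBC b b.2⟩ : C)) fun a b h => by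
      exact Subtype.ext (congrArg Subtype.val h :)
  let w : Finset (Fin (n + 1) → ℚ) := {Pi.single i 1, Pi.single j 1, Pi.single l 1}
  have h := linearIndependent_le_span_aux' _ hliB (w : Set (Fin (n + 1) → ℚ)) (by
    rintro _ ⟨b, rfl⟩
    have : f ⟨b, hBC b b.2⟩ = ∑ m, f ⟨b, hBC b b.2⟩ m • (Pi.single m 1 : Fin (n + 1) → ℚ) := by
      ext m
      simp [Finset.sum_apply, Pi.single_apply]
    simp only
    rw [this]
    refine Submodule.sum_mem _ fun m _ => ?_
    by_cases hm : m = i ∨ m = j ∨ m = l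
    · refine Submodule.smul_mem _ _ (Submodule.subset_span ?_)
      rcases hm with rfl | rfl | rfl <;> simp [w]
    · push Not at hm
      have : f ⟨b, hBC b b.2⟩ m = 0 := by
        simp [f, exponentVector, hBface b b.2 m hm.1 hm.2.1 hm.2.2]
      rw [this, zero_smul]
      exact Submodule.zero_mem _)
  rw [Fintype.card_coe] at h
  refine h.trans ?_
  simp only [Finset.coe_sort_coe, Fintype.card_coe]
  exact Finset.card_le_three

end Indecomposable

/-! ### Local structure on a triangular coordinate face. -/

section Face

variable {n d : ℕ}

/-- The exponent of the monomial `x_i^{d-α-β} x_l^α x_j^β`. -/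
noncomputable def facePoint (d : ℕ) (i l j : Fin (n + 1)) (α β : ℕ) : Fin (n + 1) →₀ ℕ :=
  Finsupp.single i (d - α - β) + Finsupp.single l α + Finsupp.single j β

variable {i l j : Fin (n + 1)}

theorem degree_facePoint {α β : ℕ} (h : α + β ≤ d) : (facePoint d i l j α β).degree = d := by
  simp only [facePoint, map_add, Finsupp.degree_single]
  omega

theorem facePoint_apply_fst (hil : i ≠ l) (hij : i ≠ j) (α β : ℕ) :
    facePoint d i l j α β i = d - α - β := by
  simp [facePoint, hil, hij]

theorem facePoint_apply_snd (hil : i ≠ l) (hlj : l ≠ j) (α β : ℕ) :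
    facePoint d i l j α β l = α := by
  simp [facePoint, hil.symm, hlj]

theorem facePoint_apply_thd (hij : i ≠ j) (hlj : l ≠ j) (α β : ℕ) :
    facePoint d i l j α β j = β := by
  simp [facePoint, hij.symm, hlj.symm]

theorem facePoint_apply_of_ne {m : Fin (n + 1)} (hi : m ≠ i) (hj : m ≠ j) (hl : m ≠ l) (α β : ℕ) :
    facePoint d i l j α β m = 0 := by
  simp [facePoint, hi, hj, hl]

theorem eq_facePoint (hil : i ≠ l) (hij : i ≠ j) (hlj : l ≠ j) {a : Fin (n + 1) →₀ ℕ}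
    (ha : a.degree = d) (h : ∀ m, m ≠ i → m ≠ j → m ≠ l → a m = 0) :
    a = facePoint d i l j (a l) (a j) := by
  have key : a = Finsupp.single i (a i) + Finsupp.single l (a l) + Finsupp.single j (a j) := by
    ext m
    by_cases h1 : m = i
    · subst h1; simp [hil, hij]
    by_cases h2 : m = j
    · subst h2; simp [hij.symm, hlj.symm]
    by_cases h3 : m = l
    · subst h3; simp [hil.symm, hlj]
    · simp [h1, h2, h3, h m h1 h2 h3]
  have hd := congrArg Finsupp.degree key
  simp only [map_add, Finsupp.degree_single] at hd
  rw [facePoint]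
  conv_lhs => rw [key]
  congr 3
  omega

variable {A : Finset (Fin (n + 1) →₀ ℕ)}

/-- Among exponents of degree `d`, the functional `2 a_i + a_j` reaches the value `2d - 1` only at
`x_i^d`, which is not in `A`, and at `x_i^(d-1) x_j`. -/
theorem isVertex_facePoint (hA : ∀ a ∈ A, a.degree = d) (hd : 2 ≤ d) (hil : i ≠ l) (hij : i ≠ j)
    (hlj : l ≠ j) (hi : Finsupp.single i d ∉ A) (hv : facePoint d i l j 0 1 ∈ A) :
    IsVertex A ⟨facePoint d i l j 0 1, hv⟩ := by
  refine ⟨2 • Finsupp.applyAddHom i + Finsupp.applyAddHom j, fun a ha => ?_⟩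
  obtain ⟨a, haA⟩ := a
  simp only [AddMonoidHom.add_apply, AddMonoidHom.nsmul_apply, Finsupp.applyAddHom_apply,
    smul_eq_mul, facePoint_apply_fst hil hij, facePoint_apply_thd hij hlj]
  by_contra hc
  have hsum : a i + a j ≤ d := by
    rw [← hA a haA, Finsupp.degree_eq_sum, ← Finset.sum_pair hij]
    exact Finset.sum_le_sum_of_subset (Finset.subset_univ _)
  have hle : Finsupp.single i (a i) + Finsupp.single j (a j) ≤ a := by
    intro m
    by_cases h1 : m = i
    · subst h1; simp [hij]
    by_cases h2 : m = j
    · subst h2; simp [hij.symm]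
    · simp [h1, h2]
  have heq := Finsupp.eq_of_le_of_degree_le hle (by
    rw [hA a haA]
    simp
    omega)
  rcases Nat.lt_or_ge (a i) d with h | h
  · refine ha (Subtype.ext ?_)
    simp only [facePoint]
    rw [← heq, show a i = d - 0 - 1 by omega, show a j = 1 by omega]
    simp
  · refine hi ?_
    rw [show a i = d by omega, show a j = 0 by omega] at heq
    simp at heq
    rwa [heq]

/-- A summand of a sum that lies in a coordinate face lies in that face. -/
theorem apply_eq_zero_of_totalExponent (s : A →₀ ℕ) {N : ℕ} {v b : A}
    (hs : totalExponent A s = N • (v : Fin (n + 1) →₀ ℕ) + b)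
    {m : Fin (n + 1)} (hv : (v : Fin (n + 1) →₀ ℕ) m = 0) (hb : (b : Fin (n + 1) →₀ ℕ) m = 0)
    (c : A) (hc : s c ≠ 0) : (c : Fin (n + 1) →₀ ℕ) m = 0 := by
  have := le_totalExponent_apply s hc m
  rw [hs] at this
  simp [hv, hb] at this
  exact this

/-- The local structure of `A` at the vertex `x_i^{d-1} x_j` of the face spanned by `x_i`, `x_l`
and `x_j`, when `x_i^{d-1} x_l` is missing. -/
theorem face_structure (hA : ∀ a ∈ A, a.degree = d) (hd : 2 ≤ d) (hil : i ≠ l) (hij : i ≠ j)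
    (hlj : l ≠ j) (hi : Finsupp.single i d ∉ A) (hv : facePoint d i l j 0 1 ∈ A)
    (hl : facePoint d i l j 1 0 ∉ A) (hedge : ∃ t, t ≤ d ∧ facePoint d i l j t 0 ∈ A)
    (hcard : ∀ B : Finset A, (∀ b ∈ B, IsIndecomposableAt ⟨_, hv⟩ b) →
      (∀ b ∈ B, ∀ m, m ≠ i → m ≠ j → m ≠ l → (b : Fin (n + 1) →₀ ℕ) m = 0) → B.card ≤ 3) :
    (∀ β γ, 2 ≤ β → β ≤ d → facePoint d i l j 0 β ∈ A → γ + 1 ≤ d →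
      facePoint d i l j 1 γ ∉ A) ∧
    ((∀ β, 2 ≤ β → β ≤ d → facePoint d i l j 0 β ∉ A) → ∀ γ γ', γ + 1 ≤ d → γ' + 1 ≤ d →
      facePoint d i l j 1 γ ∈ A → facePoint d i l j 1 γ' ∈ A → γ = γ') := by
  classical
  have hd0 : 0 < d := by omega
  have h00 : facePoint d i l j 0 0 ∉ A := by simpa [facePoint] using hi
  set v : A := ⟨_, hv⟩ with hvdef
  have hvtx : IsVertex A v := isVertex_facePoint hA hd hil hij hlj hi hv
  have hvval : (v : Fin (n + 1) →₀ ℕ) = facePoint d i l j 0 1 := rfl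
  have hface : ∀ α β m, m ≠ i → m ≠ j → m ≠ l → facePoint d i l j α β m = 0 :=
    fun α β m h1 h2 h3 => facePoint_apply_of_ne h1 h2 h3 α β
  -- coordinates of the summands of a representation of `N v + (α, β)`
  have rep : ∀ {N : ℕ} {s : A →₀ ℕ} {α β : ℕ} (h : facePoint d i l j α β ∈ A),
      totalExponent A s = N • (v : Fin (n + 1) →₀ ℕ) + (⟨_, h⟩ : A) →
      (∀ c : A, s c ≠ 0 → (c : Fin (n + 1) →₀ ℕ) = facePoint d i l j
        ((c : Fin (n + 1) →₀ ℕ) l) ((c : Fin (n + 1) →₀ ℕ) j)) ∧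
      totalExponent A s l = α ∧ totalExponent A s j = N + β := by
    intro N s α β h hs
    refine ⟨fun c hc => eq_facePoint hil hij hlj (hA c c.2) fun m h1 h2 h3 => ?_, ?_, ?_⟩
    · exact apply_eq_zero_of_totalExponent s hs (hface _ _ m h1 h2 h3) (hface _ _ m h1 h2 h3) c hc
    · rw [hs]
      simp [hvval, facePoint_apply_snd hil hlj]
    · rw [hs]
      simp [hvval, facePoint_apply_thd hij hlj]
  -- the first element of `A` on the edge from `x_i` to `x_l`
  obtain ⟨t, ht, htmin⟩ : ∃ t, (t ≤ d ∧ facePoint d i l j t 0 ∈ A) ∧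
      ∀ t', facePoint d i l j t' 0 ∈ A → t' ≤ d → t ≤ t' := by
    refine ⟨Nat.find hedge, Nat.find_spec hedge, fun t' h h' => Nat.find_min' hedge ⟨h', h⟩⟩
  have ht2 : 2 ≤ t := by
    rcases Nat.lt_or_ge t 2 with h | h
    · interval_cases t
      · exact absurd ht.2 h00
      · exact absurd ht.2 hl
    · exact h
  have hle : ∀ c : A, ∀ m, (c : Fin (n + 1) →₀ ℕ) m ≤ d := fun c m => by
    rw [← hA c c.2]
    exact Finsupp.le_degree m _
  -- A total `x_j`-degree `N` shared by `N + 1` summands leaves one summand on the edge from `x_i`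
  -- to `x_l`. Its `x_l`-degree is at most `t`, hence equal to `t` by minimality.
  have hu : IsIndecomposableAt v ⟨_, ht.2⟩ := by
    refine hvtx.isIndecomposableAt hA hd0 fun N s hs hdeg => ?_
    obtain ⟨hc, hsl, hsj⟩ := rep ht.2 hs
    obtain ⟨c, hcs, hcj⟩ : ∃ c : A, s c ≠ 0 ∧ (c : Fin (n + 1) →₀ ℕ) j = 0 := by
      by_contra! h
      have := degree_le_totalExponent_apply s (m := j)
        fun a ha => Nat.one_le_iff_ne_zero.2 (h a ha)
      omega
    have h1 := hc c hcs
    rw [hcj] at h1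
    have h2 := le_totalExponent_apply s hcs l
    rw [hsl] at h2
    have h3 := htmin _ (h1 ▸ c.2) (hle c l)
    have : c = ⟨_, ht.2⟩ := Subtype.ext (by rw [h1, le_antisymm h2 h3])
    rwa [← this]
  have hself := hvtx.isIndecomposableAt_self hA hd0
  -- on the edge from `x_i` to `x_j` all elements have positive `x_j`-degree
  have pos : ∀ c : A, (c : Fin (n + 1) →₀ ℕ) l = 0 → (c : Fin (n + 1) →₀ ℕ) = facePoint d i l j
        ((c : Fin (n + 1) →₀ ℕ) l) ((c : Fin (n + 1) →₀ ℕ) j) →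
        1 ≤ (c : Fin (n + 1) →₀ ℕ) j := by
    intro c h1 h2
    by_contra h
    rw [h1, show (c : Fin (n + 1) →₀ ℕ) j = 0 by omega] at h2
    exact h00 (h2 ▸ c.2)
  -- an element of `x_l`-degree one is a summand of `N v + (1, γ)`
  have split : ∀ {N : ℕ} {s : A →₀ ℕ} {γ : ℕ} (h : facePoint d i l j 1 γ ∈ A),
      totalExponent A s = N • (v : Fin (n + 1) →₀ ℕ) + (⟨_, h⟩ : A) → s.degree = N + 1 →
      ∃ (c : A) (r : A →₀ ℕ), s c ≠ 0 ∧ (c : Fin (n + 1) →₀ ℕ) =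
          facePoint d i l j 1 ((c : Fin (n + 1) →₀ ℕ) j) ∧ r.degree = N ∧
        totalExponent A r j + (c : Fin (n + 1) →₀ ℕ) j = N + γ ∧
        ∀ a, r a ≠ 0 → (a : Fin (n + 1) →₀ ℕ) l = 0 ∧ (a : Fin (n + 1) →₀ ℕ) = facePoint d i l j
          ((a : Fin (n + 1) →₀ ℕ) l) ((a : Fin (n + 1) →₀ ℕ) j) := by
    intro N s γ h hs hdeg
    obtain ⟨hc, hsl, hsj⟩ := rep h hs
    obtain ⟨c, hcs, hcl⟩ : ∃ c : A, s c ≠ 0 ∧ (c : Fin (n + 1) →₀ ℕ) l ≠ 0 := by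
      by_contra! h
      have : totalExponent A s l = 0 := by
        rw [totalExponent_apply]
        refine Finset.sum_eq_zero fun a _ => ?_
        by_cases ha : s a = 0
        · rw [ha, zero_mul]
        · rw [h a ha, mul_zero]
      omega
    obtain ⟨r, hr, hrt, hrd, hrs⟩ := exists_eq_single_add s hcs
    have e1 := DFunLike.congr_fun hrt l
    have e2 := DFunLike.congr_fun hrt j
    rw [Finsupp.add_apply] at e1 e2
    have hcl1 : (c : Fin (n + 1) →₀ ℕ) l = 1 := by omega
    refine ⟨c, r, hcs, ?_, by omega, by omega, fun a ha => ⟨?_, hc a (hrs a ha)⟩⟩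
    · have := hc c hcs
      rwa [hcl1] at this
    · have := le_totalExponent_apply r ha l
      omega
  -- Two indecomposables of the face other than `v` and `(t, 0)`, if distinct, would make four.
  have four : ∀ b₁ b₂ : A, IsIndecomposableAt v b₁ → IsIndecomposableAt v b₂ →
      (∀ α₁ β₁ α₂ β₂, (b₁ : Fin (n + 1) →₀ ℕ) = facePoint d i l j α₁ β₁ →
        (b₂ : Fin (n + 1) →₀ ℕ) = facePoint d i l j α₂ β₂ → (α₁, β₁) ≠ (0, 1) →
        (α₂, β₂) ≠ (0, 1) → (α₁, β₁) ≠ (t, 0) → (α₂, β₂) ≠ (t, 0) → (α₁, β₁) ≠ (α₂, β₂) →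
        False) := by
    intro b₁ b₂ h₁ h₂ α₁ β₁ α₂ β₂ e₁ e₂ n₁ n₂ n₃ n₄ n₅
    have inj : ∀ {α β α' β'}, facePoint d i l j α β = facePoint d i l j α' β' →
        (α, β) = (α', β') := by
      intro α β α' β' h
      have hl := DFunLike.congr_fun h l
      have hj := DFunLike.congr_fun h j
      rw [facePoint_apply_snd hil hlj, facePoint_apply_snd hil hlj] at hl
      rw [facePoint_apply_thd hij hlj, facePoint_apply_thd hij hlj] at hj
      rw [hl, hj]
    have hcard4 := hcard {v, ⟨_, ht.2⟩, b₁, b₂} (by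
      intro b hb
      simp only [Finset.mem_insert, Finset.mem_singleton] at hb
      rcases hb with rfl | rfl | rfl | rfl <;> assumption) (by
      intro b hb m hm1 hm2 hm3
      simp only [Finset.mem_insert, Finset.mem_singleton] at hb
      rcases hb with rfl | rfl | rfl | rfl
      · exact hface _ _ m hm1 hm2 hm3
      · exact hface _ _ m hm1 hm2 hm3
      · rw [e₁]; exact hface _ _ m hm1 hm2 hm3
      · rw [e₂]; exact hface _ _ m hm1 hm2 hm3)
    rw [Finset.card_insert_of_notMem, Finset.card_insert_of_notMem, Finset.card_pair] at hcard4
    · omega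
    · rintro rfl
      exact n₅ (inj (e₁.symm.trans e₂))
    · simp only [Finset.mem_insert, Finset.mem_singleton, not_or]
      constructor
      · rintro rfl
        exact n₃ (inj e₁).symm
      · rintro rfl
        exact n₄ (inj e₂).symm
    · simp only [Finset.mem_insert, Finset.mem_singleton, not_or]
      refine ⟨fun h => ?_, fun h => ?_, fun h => ?_⟩
      · have := inj (congrArg Subtype.val h)
        simp at this
      · rw [← h] at e₁
        exact n₁ (inj e₁).symm
      · rw [← h] at e₂
        exact n₂ (inj e₂).symm
  constructor
  · intro β γ hβ hβd hβA hγ hγA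
    -- the lowest elements on the two lines are indecomposable
    obtain ⟨β₀, ⟨hβ₀, hβ₀d, hβ₀A⟩, hβmin⟩ : ∃ β, (2 ≤ β ∧ β ≤ d ∧ facePoint d i l j 0 β ∈ A) ∧
        ∀ β', (2 ≤ β' ∧ β' ≤ d ∧ facePoint d i l j 0 β' ∈ A) → β ≤ β' := by
      have hex : ∃ β, 2 ≤ β ∧ β ≤ d ∧ facePoint d i l j 0 β ∈ A := ⟨β, hβ, hβd, hβA⟩
      exact ⟨Nat.find hex, Nat.find_spec hex, fun β' h => Nat.find_min' hex h⟩
    obtain ⟨γ₀, hγ₀A, hγmin⟩ : ∃ γ, facePoint d i l j 1 γ ∈ A ∧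
        ∀ γ', facePoint d i l j 1 γ' ∈ A → γ ≤ γ' := by
      have hex : ∃ γ, facePoint d i l j 1 γ ∈ A := ⟨γ, hγA⟩
      exact ⟨Nat.find hex, Nat.find_spec hex, fun γ' h => Nat.find_min' hex h⟩
    refine four ⟨_, hβ₀A⟩ ⟨_, hγ₀A⟩ ?_ ?_ 0 β₀ 1 γ₀ rfl rfl ?_ ?_ ?_ ?_ ?_
    · refine hvtx.isIndecomposableAt hA hd0 fun N s hs hdeg => ?_
      obtain ⟨hc, hsl, hsj⟩ := rep hβ₀A hs
      have hl0 : ∀ c : A, s c ≠ 0 → (c : Fin (n + 1) →₀ ℕ) l = 0 := fun c h => by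
        have := le_totalExponent_apply s h l
        omega
      -- The `N + 1` summands have total `x_j`-degree `N + β₀ > N + 1`, so one exceeds `1` and is
      -- then at least `β₀`. The others are at least `1`, so it is exactly `β₀`.
      obtain ⟨c, hcs, hcj⟩ : ∃ c : A, s c ≠ 0 ∧ 1 < (c : Fin (n + 1) →₀ ℕ) j := by
        by_contra! h
        have := totalExponent_apply_le_degree s h
        omega
      have h1 := hc c hcs
      rw [hl0 c hcs] at h1
      have h2 := hβmin _ ⟨hcj, hle c j, h1 ▸ c.2⟩
      obtain ⟨r, hr, hrt, hrd, hrs⟩ := exists_eq_single_add s hcs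
      have h3 := degree_le_totalExponent_apply r (m := j)
        fun a ha => pos a (hl0 a (hrs a ha)) (hc a (hrs a ha))
      have h4 := DFunLike.congr_fun hrt j
      rw [Finsupp.add_apply] at h4
      have : c = ⟨_, hβ₀A⟩ := Subtype.ext (by rw [h1]; congr 1; omega)
      rwa [← this]
    · refine hvtx.isIndecomposableAt hA hd0 fun N s hs hdeg => ?_
      obtain ⟨c, r, hcs, h1, hrd, hrj, hr⟩ := split hγ₀A hs hdeg
      have h2 := hγmin _ (h1 ▸ c.2)
      have h3 := degree_le_totalExponent_apply r (m := j) fun a ha => pos a (hr a ha).1 (hr a ha).2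
      have : c = ⟨_, hγ₀A⟩ := Subtype.ext (by rw [h1]; congr 1; omega)
      rwa [← this]
    all_goals simp
    all_goals omega
  · intro hβ γ γ' hγ hγ' hγA hγA'
    by_contra hne
    -- On the edge from `x_i` to `x_j` only `v` is left in `x_j`-degree below or equal to `d`, so
    -- all summands but the one of `x_l`-degree one have `x_j`-degree exactly one.
    have ind : ∀ γ (h : facePoint d i l j 1 γ ∈ A), IsIndecomposableAt v ⟨_, h⟩ := by
      intro γ h
      refine hvtx.isIndecomposableAt hA hd0 fun N s hs hdeg => ?_
      obtain ⟨c, r, hcs, h1, hrd, hrj, hr⟩ := split h hs hdeg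
      have h3 := degree_le_totalExponent_apply r (m := j) fun a ha => pos a (hr a ha).1 (hr a ha).2
      have h4 := totalExponent_apply_le_degree r (m := j) fun a ha => by
        by_contra hlt
        have := (hr a ha).2
        rw [(hr a ha).1] at this
        exact hβ _ (by omega) (hle a j) (this ▸ a.2)
      have : c = ⟨_, h⟩ := Subtype.ext (by rw [h1]; congr 1; omega)
      rwa [← this]
    refine four ⟨_, hγA⟩ ⟨_, hγA'⟩ (ind γ hγA) (ind γ' hγA') 1 γ 1 γ' rfl rfl ?_ ?_ ?_ ?_ ?_
    all_goals simp
    all_goals omega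

end Face

/-! ### The remaining exponents span the whole space. -/

section Span

variable {n d : ℕ} {S A : Finset (Fin (n + 1) →₀ ℕ)}

theorem lt_choose (hn : 3 ≤ n) (hd : 4 ≤ d) : 2 * (2 * n + 3) < (n + d - 1).choose (d - 1) := by
  have h1 : (n + 3).choose 3 ≤ (n + d - 1).choose (d - 1) := by
    have e1 : (n + 3).choose 3 = (n + 3).choose n := by
      rw [← Nat.choose_symm (show 3 ≤ n + 3 by omega), Nat.add_sub_cancel]
    have e2 : (n + d - 1).choose (d - 1) = (n + d - 1).choose n := by
      rw [← Nat.choose_symm (show n ≤ n + d - 1 by omega), show n + d - 1 - n = d - 1 by omega]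
    rw [e1, e2]
    exact Nat.choose_le_choose n (by omega)
  refine lt_of_lt_of_le ?_ h1
  have h2 := Nat.descFactorial_eq_factorial_mul_choose (n + 3) 3
  simp [Nat.descFactorial, Nat.factorial] at h2
  obtain ⟨m, rfl⟩ := Nat.exists_eq_add_of_le hn
  have h3 : (3 + m + 1) * ((3 + m + 1 + 1) * (3 + m + 3)) =
      m * m * m + 15 * (m * m) + 74 * m + 120 := by ring
  have h4 : (3 + m + 1) * ((3 + m + 1 + 1) * (3 + m + 3)) = 6 * (3 + m + 3).choose 3 := by
    rw [← h2]
  omega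

/-- Each element of `S` spoils at most one `m` for `p` and one for `q`, and there are more than `2
|S|` monomials of degree `d - 1`. -/
theorem exists_add_single_mem (hn : 3 ≤ n) (hd : 4 ≤ d) (hScard : S.card ≤ 2 * n + 3)
    (hA : ∀ a : Fin (n + 1) →₀ ℕ, a ∈ A ↔ a.degree = d ∧ a ∉ S) (p q : Fin (n + 1)) :
    ∃ m : Fin (n + 1) →₀ ℕ, m + Finsupp.single p 1 ∈ A ∧ m + Finsupp.single q 1 ∈ A := by
  classical
  by_contra! hc
  have hsub : (Finset.univ : Finset (Fin (n + 1))).finsuppAntidiag (d - 1) ⊆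
      S.image (· - Finsupp.single p 1) ∪ S.image (· - Finsupp.single q 1) := by
    intro m hm
    rw [Finset.mem_finsuppAntidiag, ← Finsupp.degree_eq_sum] at hm
    have hdeg : ∀ p, (m + Finsupp.single p 1).degree = d := fun p => by
      rw [map_add, Finsupp.degree_single, hm.1]
      omega
    rw [Finset.mem_union, Finset.mem_image, Finset.mem_image]
    by_cases h : m + Finsupp.single p 1 ∈ S
    · exact Or.inl ⟨_, h, add_tsub_cancel_right _ _⟩
    · have := hc m ((hA _).2 ⟨hdeg p, h⟩)
      rw [hA, not_and, not_not] at this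
      exact Or.inr ⟨_, this (hdeg q), add_tsub_cancel_right _ _⟩
  have h1 := (Finset.card_le_card hsub).trans (Finset.card_union_le _ _)
  rw [Finset.card_finsuppAntidiag_nat_eq_choose, Finset.card_univ, Fintype.card_fin] at h1
  have h2 := Finset.card_image_le (s := S) (f := (· - Finsupp.single p 1))
  have h3 := Finset.card_image_le (s := S) (f := (· - Finsupp.single q 1))
  have h4 := lt_choose hn hd
  rw [show n + 1 + (d - 1) - 1 = n + d - 1 by omega] at h1
  omega

/-- The span contains all differences of unit vectors, and adding suitable multiples of these to one
exponent of degree `d` gives `d` times any unit vector. -/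
theorem span_exponentVector_eq_top (hn : 3 ≤ n) (hd : 4 ≤ d) (hScard : S.card ≤ 2 * n + 3)
    (hA : ∀ a : Fin (n + 1) →₀ ℕ, a ∈ A ↔ a.degree = d ∧ a ∉ S) :
    Submodule.span ℚ (exponentVector '' (A : Set (Fin (n + 1) →₀ ℕ))) = ⊤ := by
  set W := Submodule.span ℚ (exponentVector '' (A : Set (Fin (n + 1) →₀ ℕ)))
  have mem : ∀ a ∈ A, exponentVector a ∈ W := fun a ha => Submodule.subset_span ⟨a, ha, rfl⟩
  have diff : ∀ p q, (Pi.single p 1 - Pi.single q 1 : Fin (n + 1) → ℚ) ∈ W := by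
    intro p q
    obtain ⟨m, hp, hq⟩ := exists_add_single_mem hn hd hScard hA p q
    have := W.sub_mem (mem _ hp) (mem _ hq)
    convert! this using 1
    ext i
    simp [exponentVector, Finsupp.single_apply, Pi.single_apply, eq_comm]
  obtain ⟨m, ha, -⟩ := exists_add_single_mem hn hd hScard hA 0 0
  set a := m + Finsupp.single 0 1
  rw [eq_top_iff, ← (Pi.basisFun ℚ (Fin (n + 1))).span_eq, Submodule.span_le]
  rintro _ ⟨p, rfl⟩
  have key : (d : ℚ) • (Pi.single p 1 : Fin (n + 1) → ℚ) = exponentVector a +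
      ∑ i, (a i : ℚ) • (Pi.single p 1 - Pi.single i 1 : Fin (n + 1) → ℚ) := by
    simp only [smul_sub, Finset.sum_sub_distrib, ← Finset.sum_smul]
    have h1 : ∑ i, (a i : ℚ) = d := by
      rw [← ((hA a).1 ha).1, Finsupp.degree_eq_sum]
      push_cast
      rfl
    have h2 : ∑ i, (a i : ℚ) • (Pi.single i 1 : Fin (n + 1) → ℚ) = exponentVector a := by
      ext j
      simp [exponentVector, Finset.sum_apply, Pi.single_apply]
    rw [h1, h2]
    abel
  have h3 : (d : ℚ) • (Pi.single p 1 : Fin (n + 1) → ℚ) ∈ W := by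
    rw [key]
    exact W.add_mem (mem a ha) (W.sum_mem fun i _ => W.smul_mem _ (diff p i))
  rw [Pi.basisFun_apply]
  exact (W.smul_mem_iff (by positivity)).1 h3

end Span

/-! ### Smoothness forces full edges. -/

section Edges

variable {n d : ℕ} {S A : Finset (Fin (n + 1) →₀ ℕ)}

/-- The exponent of the monomial `x_i^{d-α} x_l^α`. -/
noncomputable def edgePoint (d : ℕ) (i l : Fin (n + 1)) (α : ℕ) : Fin (n + 1) →₀ ℕ :=
  Finsupp.single i (d - α) + Finsupp.single l α

theorem facePoint_zero_right (i l j : Fin (n + 1)) (α : ℕ) :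
    facePoint d i l j α 0 = edgePoint d i l α := by
  simp [facePoint, edgePoint]

theorem facePoint_zero_left (i l j : Fin (n + 1)) (β : ℕ) :
    facePoint d i l j 0 β = edgePoint d i j β := by
  simp [facePoint, edgePoint]

theorem degree_edgePoint {i l : Fin (n + 1)} {α : ℕ} (h : α ≤ d) :
    (edgePoint d i l α).degree = d := by
  simp only [edgePoint, map_add, Finsupp.degree_single]
  omega

theorem edgePoint_apply_fst {i l : Fin (n + 1)} (h : i ≠ l) (α : ℕ) :
    edgePoint d i l α i = d - α := by
  simp [edgePoint, h]

theorem edgePoint_apply_snd {i l : Fin (n + 1)} (h : i ≠ l) (α : ℕ) :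
    edgePoint d i l α l = α := by
  simp [edgePoint, h.symm]

theorem edgePoint_apply_of_ne {i l m : Fin (n + 1)} (hi : m ≠ i) (hl : m ≠ l) (α : ℕ) :
    edgePoint d i l α m = 0 := by
  simp [edgePoint, hi, hl]

theorem edgePoint_symm {i l : Fin (n + 1)} {α : ℕ} (h : α ≤ d) :
    edgePoint d i l α = edgePoint d l i (d - α) := by
  rw [edgePoint, edgePoint, Nat.sub_sub_self h]
  exact add_comm _ _

theorem exists_card_three {P : (Fin (n + 1) →₀ ℕ) → Prop} {a b c : Fin (n + 1) →₀ ℕ} (ha : P a)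
    (hb : P b) (hc : P c) (hab : a ≠ b) (hac : a ≠ c) (hbc : b ≠ c) :
    ∃ E : Finset (Fin (n + 1) →₀ ℕ), E.card = 3 ∧ ∀ a ∈ E, P a := by
  classical
  refine ⟨{a, b, c}, Finset.card_eq_three.2 ⟨a, b, c, hab, hac, hbc, rfl⟩, ?_⟩
  intro x hx
  simp only [Finset.mem_insert, Finset.mem_singleton] at hx
  rcases hx with rfl | rfl | rfl <;> assumption

theorem facePoint_ne {i l j : Fin (n + 1)} (hil : i ≠ l) (hij : i ≠ j) (hlj : l ≠ j)
    {α β α' β' : ℕ} (h : α ≠ α' ∨ β ≠ β') : facePoint d i l j α β ≠ facePoint d i l j α' β' := by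
  intro he
  rcases h with h | h
  · have := DFunLike.congr_fun he l
    rw [facePoint_apply_snd hil hlj, facePoint_apply_snd hil hlj] at this
    exact h this
  · have := DFunLike.congr_fun he j
    rw [facePoint_apply_thd hij hlj, facePoint_apply_thd hij hlj] at this
    exact h this

/-- The count is `n + 1` powers, `3 (n - 1)` elements of the triples, and `x_i^(d-1) x_l`. A common
element of the triples of `m ≠ p` would involve both `x_m` and `x_p`, which forces `p = c m = j₀`
and likewise `m = c p = j₀`. -/
theorem card_ge_of_disjoint_triples (hd : 2 ≤ d) (hpow : ∀ i, Finsupp.single i d ∈ S)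
    {i l : Fin (n + 1)} (hil : i ≠ l) (hl : edgePoint d i l 1 ∈ S) {j₀ : Fin (n + 1)}
    (hj₀ : j₀ ≠ l) (c : Fin (n + 1) → Fin (n + 1)) (hc : ∀ m, c m = l ∨ c m = j₀)
    (hcj₀ : c j₀ = l)
    (E : Fin (n + 1) → Finset (Fin (n + 1) →₀ ℕ))
    (hE : ∀ m, m ≠ i → m ≠ l → (E m).card = 3 ∧ ∀ a ∈ E m, a ∈ S ∧ 1 ≤ a m ∧ a m < d ∧
      ∀ p, p ≠ i → p ≠ m → p ≠ c m → a p = 0) : 4 * n ≤ S.card + 1 := by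
  classical
  let M : Finset (Fin (n + 1)) := (Finset.univ.erase i).erase l
  have hM : ∀ {m}, m ∈ M → m ≠ i ∧ m ≠ l := fun {m} h => by
    simp only [M, Finset.mem_erase, Finset.mem_univ, and_true] at h
    exact ⟨h.2, h.1⟩
  have hMcard : M.card + 1 = n := by
    have hn : n ≠ 0 := by
      rintro rfl
      exact hil (Subsingleton.elim (α := Fin 1) _ _)
    rw [Finset.card_erase_of_mem (by simp [hil.symm]), Finset.card_erase_of_mem (by simp)]
    simp
    omega
  let U₁ : Finset (Fin (n + 1) →₀ ℕ) := Finset.univ.image fun i => Finsupp.single i d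
  let U₂ := M.biUnion E
  have h₁ : U₁.card = n + 1 := by
    rw [Finset.card_image_of_injective, Finset.card_univ, Fintype.card_fin]
    intro p q h
    exact (Finsupp.single_left_inj (by omega)).1 h
  have hsupp : ∀ {m p}, m ∈ M → p ∈ M → m ≠ p → ∀ {a}, a ∈ E m → a p ≠ 0 → p = j₀ ∧ c m = j₀ := by
    intro m p hm hp hmp a ha hap
    by_contra hne
    refine hap (((hE m (hM hm).1 (hM hm).2).2 a ha).2.2.2 p (hM hp).1 hmp.symm ?_)
    rintro rfl
    rcases hc m with h | h
    · exact (hM hp).2 h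
    · exact hne ⟨h, h⟩
  have h₂ : U₂.card = M.card * 3 := by
    refine Finset.card_biUnion (fun m hm p hp hmp => ?_) |>.trans ?_
    · refine Finset.disjoint_left.2 fun a ham hap => ?_
      have h1 := hsupp hm hp hmp ham
        (by have := ((hE p (hM hp).1 (hM hp).2).2 a hap).2.1; omega)
      have h2 := hsupp hp hm hmp.symm hap
        (by have := ((hE m (hM hm).1 (hM hm).2).2 a ham).2.1; omega)
      exact hmp (h2.1.trans h1.1.symm)
    · rw [Finset.sum_congr rfl fun m hm => (hE m (hM hm).1 (hM hm).2).1, Finset.sum_const,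
        smul_eq_mul]
  have hdisj : Disjoint U₁ U₂ := by
    refine Finset.disjoint_left.2 fun a ha ha' => ?_
    obtain ⟨p, -, rfl⟩ := Finset.mem_image.1 ha
    obtain ⟨m, hm, ha'⟩ := Finset.mem_biUnion.1 ha'
    obtain ⟨-, h1, h2, -⟩ := (hE m (hM hm).1 (hM hm).2).2 _ ha'
    rw [Finsupp.single_apply] at h1 h2
    split_ifs at h1 h2 <;> omega
  have hnot : edgePoint d i l 1 ∉ U₁ ∪ U₂ := by
    rw [Finset.mem_union, not_or]
    constructor
    · intro h
      obtain ⟨p, -, h⟩ := Finset.mem_image.1 h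
      have e1 := DFunLike.congr_fun h i
      have e2 := DFunLike.congr_fun h l
      rw [edgePoint_apply_fst hil, Finsupp.single_apply] at e1
      rw [edgePoint_apply_snd hil, Finsupp.single_apply] at e2
      split_ifs at e1 e2 <;> omega
    · intro h
      obtain ⟨m, hm, h⟩ := Finset.mem_biUnion.1 h
      obtain ⟨-, h1, -⟩ := (hE m (hM hm).1 (hM hm).2).2 _ h
      rw [edgePoint_apply_of_ne (hM hm).1 (hM hm).2] at h1
      omega
  have hsub : insert (edgePoint d i l 1) (U₁ ∪ U₂) ⊆ S := by
    refine Finset.insert_subset hl (Finset.union_subset ?_ ?_)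
    · intro a ha
      obtain ⟨p, -, rfl⟩ := Finset.mem_image.1 ha
      exact hpow p
    · intro a ha
      obtain ⟨m, hm, ha⟩ := Finset.mem_biUnion.1 ha
      exact ((hE m (hM hm).1 (hM hm).2).2 a ha).1
  have := Finset.card_le_card hsub
  rw [Finset.card_insert_of_notMem hnot, Finset.card_union_of_disjoint hdisj, h₁, h₂] at this
  omega

/-- If `X` is smooth and the monomial `x_i^{d-1} x_l` is among the generators, then so are all the
monomials in `x_i` and `x_l`. -/
theorem edgePoint_mem_of_smooth {k : Type*} [Field k] [Infinite k] (hn : 3 ≤ n) (hd : 4 ≤ d)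
    (hScard : S.card ≤ 2 * n + 3) (hpow : ∀ i, Finsupp.single i d ∈ S)
    (hA : ∀ a : Fin (n + 1) →₀ ℕ, a ∈ A ↔ a.degree = d ∧ a ∉ S)
    (hsmooth : IsSmoothProjectiveVariety
      (MvPolynomial.vanishingIdeal k (Set.range (monomialMap k A))))
    (hJ : ∀ i, ∃ j, j ≠ i ∧ edgePoint d i j 1 ∉ S) {i l : Fin (n + 1)} (hil : i ≠ l)
    (hl : edgePoint d i l 1 ∈ S) {α : ℕ} (hα : α ≤ d) : edgePoint d i l α ∈ S := by
  classical
  by_contra hαS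
  have hAdeg : ∀ a ∈ A, a.degree = d := fun a ha => ((hA a).1 ha).1
  have hspan := span_exponentVector_eq_top hn hd hScard hA
  have hi : Finsupp.single i d ∉ A := fun h => ((hA _).1 h).2 (hpow i)
  have memS : ∀ {a : Fin (n + 1) →₀ ℕ}, a.degree = d → a ∉ A → a ∈ S := fun {a} h h' => by
    by_contra hc
    exact h' ((hA a).2 ⟨h, hc⟩)
  have memA : ∀ {a : Fin (n + 1) →₀ ℕ}, a.degree = d → a ∉ S → a ∈ A := fun {a} h h' =>
    (hA a).2 ⟨h, h'⟩
  have hdeg : ∀ {l j : Fin (n + 1)} {α β : ℕ}, α + β ≤ d → (facePoint d i l j α β).degree = d :=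
    fun h => degree_facePoint h
  -- the local structure at a vertex of a face
  have face : ∀ {l j : Fin (n + 1)}, i ≠ l → i ≠ j → l ≠ j → edgePoint d i j 1 ∉ S →
      edgePoint d i l 1 ∈ S → (∃ α, α ≤ d ∧ edgePoint d i l α ∉ S) →
      (∀ β γ, 2 ≤ β → β ≤ d → facePoint d i l j 0 β ∈ A → γ + 1 ≤ d →
        facePoint d i l j 1 γ ∉ A) ∧
      ((∀ β, 2 ≤ β → β ≤ d → facePoint d i l j 0 β ∉ A) → ∀ γ γ', γ + 1 ≤ d → γ' + 1 ≤ d →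
        facePoint d i l j 1 γ ∈ A → facePoint d i l j 1 γ' ∈ A → γ = γ') := by
    intro l j hil hij hlj hj hl ⟨α, hα, hαS⟩
    have hv : facePoint d i l j 0 1 ∈ A := by
      rw [facePoint_zero_left]
      exact memA (degree_edgePoint (by omega)) hj
    have hvtx := isVertex_facePoint hAdeg (by omega) hil hij hlj hi hv
    refine face_structure hAdeg (by omega) hil hij hlj hi hv ?_ ⟨α, hα, ?_⟩ ?_
    · rw [facePoint_zero_right]
      exact fun h => ((hA _).1 h).2 hl
    · rw [facePoint_zero_right]
      exact memA (degree_edgePoint hα) hαS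
    · intro B hB hBf
      refine hvtx.card_le_three hAdeg (by omega) hspan (fun B hB => ?_) i j l hB hBf
      exact hsmooth.card_le (fun N s hs => hvtx.eq_single hAdeg (by omega) hs) hB
  obtain ⟨j₀, hj₀i, hj₀⟩ := hJ i
  have hj₀l : j₀ ≠ l := by
    rintro rfl
    exact hj₀ hl
  -- The triangle used for `m` is `{i, m, j₀}` or `{i, l, m}`, according to whether `x_i^(d-1) x_m`
  -- is a generator; in either case one of the two other corners gives a vertex of `A` next to
  -- `x_i^d`.
  have triple : ∀ m, m ≠ i → m ≠ l → ∃ E : Finset (Fin (n + 1) →₀ ℕ), E.card = 3 ∧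
      ∀ a ∈ E, a ∈ S ∧ 1 ≤ a m ∧ a m < d ∧ ∀ p, p ≠ i → p ≠ m →
        p ≠ (if edgePoint d i m 1 ∈ S then j₀ else l) → a p = 0 := by
    intro m hmi hml
    have hne : ∀ {l j : Fin (n + 1)} {α β α' β' : ℕ}, i ≠ l → i ≠ j → l ≠ j →
        (α ≠ α' ∨ β ≠ β') → facePoint d i l j α β ≠ facePoint d i l j α' β' :=
      fun h1 h2 h3 h => facePoint_ne h1 h2 h3 h
    by_cases hm : edgePoint d i m 1 ∈ S
    · rw [if_pos hm]
      have him := hmi.symm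
      by_cases hfull : ∃ α, α ≤ d ∧ edgePoint d i m α ∉ S
      · -- face spanned by `i`, `m`, `j₀`
        have hmj₀ : m ≠ j₀ := by
          rintro rfl
          exact hj₀ hm
        have pt : ∀ γ, γ + 1 ≤ d → facePoint d i m j₀ 1 γ ∉ A →
            facePoint d i m j₀ 1 γ ∈ S ∧ 1 ≤ facePoint d i m j₀ 1 γ m ∧
              facePoint d i m j₀ 1 γ m < d ∧ ∀ p, p ≠ i → p ≠ m → p ≠ j₀ →
                facePoint d i m j₀ 1 γ p = 0 := by
          intro γ hγ h
          rw [facePoint_apply_snd him hmj₀]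
          exact ⟨memS (hdeg (by omega)) h, le_rfl, by omega, fun p h1 h2 h3 =>
            facePoint_apply_of_ne h1 h3 h2 _ _⟩
        obtain ⟨f1, f2⟩ := face him hj₀i.symm hmj₀ hj₀ hm hfull
        have hone : ∀ γ γ', γ + 1 ≤ d → γ' + 1 ≤ d → facePoint d i m j₀ 1 γ ∈ A →
            facePoint d i m j₀ 1 γ' ∈ A → γ = γ' := by
          by_cases hβ : ∃ β, 2 ≤ β ∧ β ≤ d ∧ facePoint d i m j₀ 0 β ∈ A
          · obtain ⟨β, h1, h2, h3⟩ := hβ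
            intro γ γ' hγ _ h _
            exact absurd h (f1 β γ h1 h2 h3 hγ)
          · push Not at hβ
            exact f2 hβ
        have h0 : facePoint d i m j₀ 1 0 ∉ A := by
          rw [facePoint_zero_right]
          exact fun h => ((hA _).1 h).2 hm
        -- At most one of `γ = 1, 2, 3` gives an element of `A`; these values are admissible because
        -- `d ≥ 4`.
        obtain ⟨γ, γ', hγ, hγ0, hγ0', hγd, hγd', h1, h2⟩ : ∃ γ γ', γ ≠ γ' ∧ γ ≠ 0 ∧ γ' ≠ 0 ∧
            γ + 1 ≤ d ∧ γ' + 1 ≤ d ∧ facePoint d i m j₀ 1 γ ∉ A ∧ facePoint d i m j₀ 1 γ' ∉ A := by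
          by_cases h1 : facePoint d i m j₀ 1 1 ∈ A
          · refine ⟨2, 3, by omega, by omega, by omega, by omega, by omega,
              fun h => ?_, fun h => ?_⟩
            · have := hone 1 2 (by omega) (by omega) h1 h
              omega
            · have := hone 1 3 (by omega) (by omega) h1 h
              omega
          · by_cases h2 : facePoint d i m j₀ 1 2 ∈ A
            · refine ⟨1, 3, by omega, by omega, by omega, by omega, by omega, h1, fun h => ?_⟩
              have := hone 2 3 (by omega) (by omega) h2 h
              omega
            · exact ⟨1, 2, by omega, by omega, by omega, by omega, by omega, h1, h2⟩
        exact exists_card_three (pt 0 (by omega) h0) (pt γ hγd h1) (pt γ' hγd' h2)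
          (hne him hj₀i.symm hmj₀ (Or.inr hγ0.symm)) (hne him hj₀i.symm hmj₀ (Or.inr hγ0'.symm))
          (hne him hj₀i.symm hmj₀ (Or.inr hγ))
      · push Not at hfull
        have pt : ∀ α, 1 ≤ α → α < d → edgePoint d i m α ∈ S ∧ 1 ≤ edgePoint d i m α m ∧
            edgePoint d i m α m < d ∧ ∀ p, p ≠ i → p ≠ m → p ≠ j₀ → edgePoint d i m α p = 0 := by
          intro α h1 h2
          rw [edgePoint_apply_snd him]
          exact ⟨hfull α h2.le, h1, h2, fun p h1 h2 _ => edgePoint_apply_of_ne h1 h2 _⟩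
        have inj : ∀ α β, α ≠ β → edgePoint d i m α ≠ edgePoint d i m β := by
          intro α β h he
          have := DFunLike.congr_fun he m
          rw [edgePoint_apply_snd him, edgePoint_apply_snd him] at this
          exact h this
        exact exists_card_three (pt 1 (by omega) (by omega)) (pt 2 (by omega) (by omega))
          (pt 3 (by omega) (by omega)) (inj _ _ (by omega)) (inj _ _ (by omega))
          (inj _ _ (by omega))
    · rw [if_neg hm]
      -- face spanned by `i`, `l`, `m`
      have him := hmi.symm
      have hlm := hml.symm
      obtain ⟨f1, f2⟩ := face hil him hlm hm hl ⟨α, hα, hαS⟩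
      have pt : ∀ α β, 1 ≤ β → β < d → α + β ≤ d → facePoint d i l m α β ∉ A →
          facePoint d i l m α β ∈ S ∧ 1 ≤ facePoint d i l m α β m ∧
            facePoint d i l m α β m < d ∧ ∀ p, p ≠ i → p ≠ m → p ≠ l →
              facePoint d i l m α β p = 0 := by
        intro α β h1 h2 h3 h
        rw [facePoint_apply_thd him hlm]
        exact ⟨memS (hdeg h3) h, h1, h2, fun p h1 h2 h3 => facePoint_apply_of_ne h1 h2 h3 _ _⟩
      -- Either the whole line of `x_l`-degree one consists of generators, or the edge from `x_i` to
      -- `x_m` does from `β = 2` on and the line has at most one element of `A`.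
      by_cases hβ : ∃ β, 2 ≤ β ∧ β ≤ d ∧ facePoint d i l m 0 β ∈ A
      · obtain ⟨β, h1, h2, h3⟩ := hβ
        have pt' : ∀ γ, 1 ≤ γ → γ + 1 ≤ d → _ := fun γ h h' =>
          pt 1 γ h (by omega) (by omega) (f1 β γ h1 h2 h3 h')
        exact exists_card_three (pt' 1 (by omega) (by omega)) (pt' 2 (by omega) (by omega))
          (pt' 3 (by omega) (by omega)) (hne hil him hlm (Or.inr (by omega)))
          (hne hil him hlm (Or.inr (by omega))) (hne hil him hlm (Or.inr (by omega)))
      · push Not at hβ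
        obtain ⟨γ, hγ1, hγd, hγ⟩ : ∃ γ, 1 ≤ γ ∧ γ + 1 < d ∧ facePoint d i l m 1 γ ∉ A := by
          by_cases h1 : facePoint d i l m 1 1 ∈ A
          · refine ⟨2, by omega, by omega, fun h => ?_⟩
            have := f2 hβ 1 2 (by omega) (by omega) h1 h
            omega
          · exact ⟨1, by omega, by omega, h1⟩
        exact exists_card_three
          (pt 0 2 (by omega) (by omega) (by omega) (hβ 2 (by omega) (by omega)))
          (pt 0 3 (by omega) (by omega) (by omega) (hβ 3 (by omega) (by omega)))
          (pt 1 γ hγ1 (by omega) (by omega) hγ) (hne hil him hlm (Or.inr (by omega)))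
          (hne hil him hlm (Or.inl (by omega))) (hne hil him hlm (Or.inl (by omega)))
  choose! E hE using triple
  have := card_ge_of_disjoint_triples (by omega) hpow hil hl hj₀l
    (fun m => if edgePoint d i m 1 ∈ S then j₀ else l) (fun m => by
      split_ifs
      · exact Or.inr rfl
      · exact Or.inl rfl) (if_neg hj₀) E hE
  omega

end Edges

/-! ### Arithmetic of the tetrahedron. -/

/-- The bound on the number of monomials on an edge that is not blocked by the adjacent faces. -/
def EdgeBound (P Q : Prop) (p : ℕ) : Prop :=
  (P ∨ Q → 1 ≤ p) ∧ (¬ (P ↔ Q) → 2 ≤ p)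

/-- For a tetrahedron without full edges: `P` records which powers of variables occur in the
product, `p` counts monomials inside edges, and `w` counts those inside the face opposite the given
vertex. The sixteen patterns of `P` are checked separately. -/
theorem six_le_of_clean
    {P0 P1 P2 P3 : Prop} {p01 p02 p03 p12 p13 p23 w0 w1 w2 w3 : ℕ}
    (hP : P0 ∨ P1 ∨ P2 ∨ P3)
    (e01 : ¬ (P0 ↔ P1) → 1 ≤ p01) (e02 : ¬ (P0 ↔ P2) → 1 ≤ p02) (e03 : ¬ (P0 ↔ P3) → 1 ≤ p03)
    (e12 : ¬ (P1 ↔ P2) → 1 ≤ p12) (e13 : ¬ (P1 ↔ P3) → 1 ≤ p13) (e23 : ¬ (P2 ↔ P3) → 1 ≤ p23)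
    (a3 : w3 = 0 → EdgeBound P0 P1 p01 ∧ EdgeBound P0 P2 p02 ∧ EdgeBound P1 P2 p12)
    (b3 : w3 = 1 → EdgeBound P0 P1 p01 ∨ EdgeBound P0 P2 p02 ∨ EdgeBound P1 P2 p12)
    (a2 : w2 = 0 → EdgeBound P0 P1 p01 ∧ EdgeBound P0 P3 p03 ∧ EdgeBound P1 P3 p13)
    (b2 : w2 = 1 → EdgeBound P0 P1 p01 ∨ EdgeBound P0 P3 p03 ∨ EdgeBound P1 P3 p13)
    (a1 : w1 = 0 → EdgeBound P0 P2 p02 ∧ EdgeBound P0 P3 p03 ∧ EdgeBound P2 P3 p23)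
    (b1 : w1 = 1 → EdgeBound P0 P2 p02 ∨ EdgeBound P0 P3 p03 ∨ EdgeBound P2 P3 p23)
    (a0 : w0 = 0 → EdgeBound P1 P2 p12 ∧ EdgeBound P1 P3 p13 ∧ EdgeBound P2 P3 p23)
    (b0 : w0 = 1 → EdgeBound P1 P2 p12 ∨ EdgeBound P1 P3 p13 ∨ EdgeBound P2 P3 p23) :
    6 ≤ p01 + p02 + p03 + p12 + p13 + p23 + (w0 + w1 + w2 + w3) := by
  unfold EdgeBound at *
  by_cases h0 : P0 <;> by_cases h1 : P1 <;> by_cases h2 : P2 <;> by_cases h3 : P3 <;>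
    simp only [h0, h1, h2, h3, not_true_eq_false, not_false_eq_true, iff_true, iff_false,
      true_or, or_true, or_false, true_and, forall_const, false_implies, implies_true,
      iff_self] at * <;>
    clear h0 h1 h2 h3 <;> omega

/-- The edge `01` is full, so only the two faces not containing it give conditions. -/
theorem six_le_of_full
    {P0 P1 P2 P3 : Prop} {p01 p02 p03 p12 p13 p23 w0 w1 w2 w3 : ℕ}
    (hP : P0 ∨ P1 ∨ P2 ∨ P3) (H01 : 3 ≤ p01)
    (e02 : ¬ (P0 ↔ P2) → 1 ≤ p02) (e03 : ¬ (P0 ↔ P3) → 1 ≤ p03)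
    (e12 : ¬ (P1 ↔ P2) → 1 ≤ p12) (e13 : ¬ (P1 ↔ P3) → 1 ≤ p13) (e23 : ¬ (P2 ↔ P3) → 1 ≤ p23)
    (a1 : w1 = 0 → EdgeBound P0 P2 p02 ∧ EdgeBound P0 P3 p03 ∧ EdgeBound P2 P3 p23)
    (b1 : w1 = 1 → EdgeBound P0 P2 p02 ∨ EdgeBound P0 P3 p03 ∨ EdgeBound P2 P3 p23)
    (a0 : w0 = 0 → EdgeBound P1 P2 p12 ∧ EdgeBound P1 P3 p13 ∧ EdgeBound P2 P3 p23)
    (b0 : w0 = 1 → EdgeBound P1 P2 p12 ∨ EdgeBound P1 P3 p13 ∨ EdgeBound P2 P3 p23) :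
    6 ≤ p01 + p02 + p03 + p12 + p13 + p23 + (w0 + w1 + w2 + w3) := by
  unfold EdgeBound at *
  by_cases h0 : P0 <;> by_cases h1 : P1 <;> by_cases h2 : P2 <;> by_cases h3 : P3 <;>
    simp only [h0, h1, h2, h3, not_true_eq_false, not_false_eq_true, iff_true, iff_false,
      true_or, or_true, or_false, true_and, forall_const, false_implies, implies_true,
      iff_self] at * <;>
    clear h0 h1 h2 h3 <;> omega

/-! ### Polynomials in one variable with a root at `-1`. -/

section Telescope

variable {k : Type*} [Field k]

/-- This evaluates `(1 + x) P(x)` at `x = -1`, up to the boundary term of the truncation. -/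
theorem sum_neg_one_pow_telescope (P : ℕ → k) (m : ℕ) :
    ∑ b ∈ Finset.range (m + 1), (-1) ^ b * (P b + if b = 0 then 0 else P (b - 1)) =
      (-1) ^ m * P m := by
  induction m with
  | zero => simp
  | succ m ih =>
    rw [Finset.sum_range_succ, ih, pow_succ, if_neg (Nat.succ_ne_zero m), Nat.add_sub_cancel]
    ring

/-- Applying `x d/dx` to `(1 + x) P(x)` and setting `x = -1` leaves `-P(-1)`, up to truncation. -/
theorem sum_neg_one_pow_mul_telescope (P : ℕ → k) (m : ℕ) :
    ∑ b ∈ Finset.range (m + 1), (-1) ^ b * b * (P b + if b = 0 then 0 else P (b - 1)) =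
      (-1) ^ m * m * P m - ∑ b ∈ Finset.range m, (-1) ^ b * P b := by
  induction m with
  | zero => simp
  | succ m ih =>
    rw [Finset.sum_range_succ, ih, Finset.sum_range_succ _ m, pow_succ,
      if_neg (Nat.succ_ne_zero m), Nat.add_sub_cancel]
    push_cast
    ring

variable [CharZero k]

theorem exists_ne_zero_of_sum_eq_zero {d : ℕ} (hd : d ≠ 0) {G : ℕ → k}
    (h0 : ∑ b ∈ Finset.range (d + 1), (-1) ^ b * G b = 0) (h : ¬ (G 0 ≠ 0 ↔ G d ≠ 0)) :
    ∃ b, 1 ≤ b ∧ b < d ∧ G b ≠ 0 := by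
  by_contra! hc
  have : ∑ b ∈ Finset.range (d + 1), (-1) ^ b * G b = G 0 + (-1) ^ d * G d := by
    rw [Finset.sum_range_succ, Finset.sum_eq_single_of_mem 0 (by simp; omega)]
    · simp
    · intro b hb hb0
      rw [hc b (by omega) (by simpa using hb), mul_zero]
  rw [this] at h0
  refine h ⟨fun h1 h2 => h1 (by simpa [h2] using h0), fun h1 h2 => h1 (by simpa [h2] using h0)⟩

/-- In characteristic zero a nonzero polynomial with a double root at `-1` has at least three terms.
-/
theorem exists_ne_zero_of_sums_eq_zero {d : ℕ} (hd : d ≠ 0) {G : ℕ → k}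
    (h0 : ∑ b ∈ Finset.range (d + 1), (-1) ^ b * G b = 0)
    (h1 : ∑ b ∈ Finset.range (d + 1), (-1) ^ b * b * G b = 0) :
    (G 0 ≠ 0 ∨ G d ≠ 0 → ∃ b, 1 ≤ b ∧ b < d ∧ G b ≠ 0) ∧
    (¬ (G 0 ≠ 0 ↔ G d ≠ 0) → ∃ b c, b ≠ c ∧ 1 ≤ b ∧ b < d ∧ 1 ≤ c ∧ c < d ∧ G b ≠ 0 ∧
      G c ≠ 0) := by
  have hd' : (d : k) ≠ 0 := Nat.cast_ne_zero.2 hd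
  have hs : ∀ m : ℕ, ((-1 : k)) ^ m ≠ 0 := fun m => pow_ne_zero _ (by simp)
  constructor
  · intro h
    by_contra! hc
    by_cases hiff : G 0 ≠ 0 ↔ G d ≠ 0
    · have : ∑ b ∈ Finset.range (d + 1), (-1) ^ b * b * G b = (-1) ^ d * d * G d := by
        rw [Finset.sum_range_succ, Finset.sum_eq_zero, zero_add]
        intro b hb
        by_cases hb0 : b = 0
        · simp [hb0]
        · rw [hc b (by omega) (by simpa using hb), mul_zero]
      rw [this] at h1
      have : G d = 0 := by simpa [hd', hs] using h1
      tauto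
    · obtain ⟨b, hb, hbd, hb0⟩ := exists_ne_zero_of_sum_eq_zero hd h0 hiff
      exact hb0 (hc b hb hbd)
  · intro hiff
    obtain ⟨b, hb, hbd, hb0⟩ := exists_ne_zero_of_sum_eq_zero hd h0 hiff
    by_contra! hc
    have hc' : ∀ c, 1 ≤ c → c < d → c ≠ b → G c = 0 := fun c h h' hne =>
      hc b c hne.symm hb hbd h h' hb0
    have expand : ∀ F : ℕ → k, (∀ c, c ≠ 0 → c ≠ b → c < d → F c = 0) →
        ∑ b ∈ Finset.range (d + 1), F b = F 0 + F b + F d := by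
      intro F hF
      rw [Finset.sum_range_succ, ← Finset.sum_subset (s₁ := {0, b}), Finset.sum_pair (by omega)]
      · intro c hc
        simp only [Finset.mem_insert, Finset.mem_singleton] at hc
        simp only [Finset.mem_range]
        omega
      · intro c hcd hc
        simp only [Finset.mem_insert, Finset.mem_singleton, not_or] at hc
        exact hF c hc.1 hc.2 (by simpa using hcd)
    rw [expand _ fun c h h' h'' => by rw [hc' c (by omega) h'' h', mul_zero]] at h0 h1
    simp only [pow_zero, one_mul, Nat.cast_zero, mul_zero, zero_mul, zero_add] at h0 h1
    have hb' : (b : k) ≠ 0 := Nat.cast_ne_zero.2 (by omega)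
    by_cases hGd : G d = 0
    · rw [hGd, mul_zero, add_zero] at h1
      exact hb0 (by simpa [hs, hb'] using h1)
    · have hG0 : G 0 = 0 := by
        by_contra hne
        exact hiff ⟨fun _ => hGd, fun _ => hne⟩
      -- Subtracting `b` times the first relation from the second eliminates `G b`.
      have : (-1) ^ d * ((d : k) - b) * G d = 0 := by
        linear_combination h1 - (b : k) * h0 + (b : k) * hG0
      have hdb : (d : k) - b ≠ 0 := sub_ne_zero.2 (by exact_mod_cast hbd.ne')
      exact hGd (by simpa [hs, hdb] using this)

end Telescope

/-! ### Restriction of the product to faces and edges. -/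

section FaceCoefficients

variable {k : Type*} [Field k] {n e : ℕ} {i l j : Fin (n + 1)}

theorem facePoint_sub_single_fst (α β : ℕ) (h : α + β ≤ e) :
    facePoint (e + 1) i l j α β - Finsupp.single i 1 = facePoint e i l j α β := by
  refine tsub_eq_of_eq_add ?_
  rw [facePoint, facePoint, show e + 1 - α - β = e - α - β + 1 by omega, Finsupp.single_add]
  abel

theorem facePoint_sub_single_snd (α β : ℕ) :
    facePoint (e + 1) i l j (α + 1) β - Finsupp.single l 1 = facePoint e i l j α β := by
  refine tsub_eq_of_eq_add ?_
  rw [facePoint, facePoint, show e + 1 - (α + 1) - β = e - α - β by omega, Finsupp.single_add]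
  abel

theorem facePoint_sub_single_thd (α β : ℕ) :
    facePoint (e + 1) i l j α (β + 1) - Finsupp.single j 1 = facePoint e i l j α β := by
  refine tsub_eq_of_eq_add ?_
  rw [facePoint, facePoint, show e + 1 - α - (β + 1) = e - α - β by omega, Finsupp.single_add]
  abel

/-- The coefficients of the restriction of a form of degree `e` to a face. -/
noncomputable def faceCoeff (φ : (Fin (n + 1) →₀ ℕ) → k) (e : ℕ) (i l j : Fin (n + 1))
    (α β : ℕ) : k :=
  if α + β ≤ e then φ (facePoint e i l j α β) else 0

theorem shiftSum_facePoint (φ : (Fin (n + 1) →₀ ℕ) → k) (hil : i ≠ l) (hij : i ≠ j) (hlj : l ≠ j)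
    {α β : ℕ} (h : α + β ≤ e + 1) : shiftSum Finset.univ φ (facePoint (e + 1) i l j α β) =
      faceCoeff φ e i l j α β + (if α = 0 then 0 else faceCoeff φ e i l j (α - 1) β) +
        if β = 0 then 0 else faceCoeff φ e i l j α (β - 1) := by
  classical
  have hsub : ∑ m ∈ {i, l, j}, (if facePoint (e + 1) i l j α β m = 0 then 0 else
      φ (facePoint (e + 1) i l j α β - Finsupp.single m 1)) =
        shiftSum Finset.univ φ (facePoint (e + 1) i l j α β) := by
    refine Finset.sum_subset (Finset.subset_univ _) fun m _ hm => ?_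
    simp only [Finset.mem_insert, Finset.mem_singleton, not_or] at hm
    rw [if_pos (facePoint_apply_of_ne hm.1 hm.2.2 hm.2.1 _ _)]
  rw [← hsub, Finset.sum_insert (by simp [hil, hij]), Finset.sum_pair hlj,
    facePoint_apply_fst hil hij, facePoint_apply_snd hil hlj, facePoint_apply_thd hij hlj,
    ← add_assoc]
  congr 1
  · congr 1
    · rw [faceCoeff]
      by_cases hc : α + β ≤ e
      · rw [if_pos hc, if_neg (by omega), facePoint_sub_single_fst _ _ hc]
      · rw [if_neg hc, if_pos (by omega)]
    · rcases α with _ | α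
      · simp
      · rw [if_neg (by omega), if_neg (by omega), facePoint_sub_single_snd, faceCoeff,
          if_pos (by omega), Nat.add_sub_cancel]
  · rcases β with _ | β
    · simp
    · rw [if_neg (by omega), if_neg (by omega), facePoint_sub_single_thd, faceCoeff,
        if_pos (by omega), Nat.add_sub_cancel]

/-- On the edge the product restricts to a multiple of `x_i + x_j`, which vanishes at `(1, -1)`. The
boundary term is zero because `faceCoeff` is zero beyond degree `e`. -/
theorem sum_edge_eq_zero (φ : (Fin (n + 1) →₀ ℕ) → k) (hil : i ≠ l) (hij : i ≠ j) (hlj : l ≠ j) :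
    ∑ b ∈ Finset.range (e + 1 + 1),
      (-1) ^ b * shiftSum Finset.univ φ (edgePoint (e + 1) i j b) = 0 := by
  have := sum_neg_one_pow_telescope (faceCoeff φ e i l j 0) (e + 1)
  rw [faceCoeff, if_neg (by omega), mul_zero] at this
  rw [← this]
  refine Finset.sum_congr rfl fun b hb => ?_
  rw [← facePoint_zero_left i l j, shiftSum_facePoint φ hil hij hlj (by simp at hb; omega)]
  simp

/-- If the product has no monomials on the line next to an edge, then the restriction of the
product to this edge is divisible by the square of the sum of the two variables. -/
theorem sum_mul_edge_eq_zero (φ : (Fin (n + 1) →₀ ℕ) → k) (hil : i ≠ l) (hij : i ≠ j)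
    (hlj : l ≠ j)
    (h : ∀ b, b ≤ e → shiftSum Finset.univ φ (facePoint (e + 1) i l j 1 b) = 0) :
    ∑ b ∈ Finset.range (e + 1 + 1),
      (-1) ^ b * b * shiftSum Finset.univ φ (edgePoint (e + 1) i j b) = 0 := by
  have h1 := sum_neg_one_pow_mul_telescope (faceCoeff φ e i l j 0) (e + 1)
  rw [faceCoeff, if_neg (by omega), mul_zero, zero_sub] at h1
  have h2 := sum_neg_one_pow_telescope (faceCoeff φ e i l j 1) e
  rw [faceCoeff, if_neg (by omega), mul_zero] at h2
  -- Writing the form on the face as `F₀ + x_l F₁ + ⋯`, the coefficient of `x_l` in the product is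
  -- `F₀ + (x_i + x_j) F₁`. It vanishes, so `F₀` vanishes at `(1, -1)`.
  have h3 : ∑ b ∈ Finset.range (e + 1), (-1) ^ b * faceCoeff φ e i l j 0 b = 0 := by
    rw [← neg_eq_zero, ← Finset.sum_neg_distrib, ← h2]
    refine Finset.sum_congr rfl fun b hb => ?_
    have hb' : b ≤ e := by simpa [Nat.lt_succ_iff] using hb
    have := h b hb'
    rw [shiftSum_facePoint φ hil hij hlj (by omega), if_neg one_ne_zero, Nat.sub_self] at this
    linear_combination -(-1) ^ b * this
  rw [h3, neg_zero] at h1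
  rw [← h1]
  refine Finset.sum_congr rfl fun b hb => ?_
  rw [← facePoint_zero_left i l j, shiftSum_facePoint φ hil hij hlj (by simp at hb; omega)]
  simp

end FaceCoefficients

/-! ### Counting monomials by the face in whose interior they lie. -/

section Supports

variable {n d : ℕ}

theorem support_edgePoint {i j : Fin (n + 1)} (hij : i ≠ j) {b : ℕ} (h1 : 1 ≤ b) (h2 : b < d) :
    (edgePoint d i j b).support = {i, j} := by
  ext m
  rw [Finsupp.mem_support_iff, Finset.mem_insert, Finset.mem_singleton]
  by_cases hi : m = i
  · subst hi
    rw [edgePoint_apply_fst hij]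
    simp
    omega
  by_cases hj : m = j
  · subst hj
    rw [edgePoint_apply_snd hij]
    simp
    omega
  · simp [edgePoint_apply_of_ne hi hj, hi, hj]

theorem support_facePoint {i l j : Fin (n + 1)} (hil : i ≠ l) (hij : i ≠ j) (hlj : l ≠ j) {α β : ℕ}
    (h1 : 1 ≤ α) (h2 : 1 ≤ β) (h3 : α + β < d) :
    (facePoint d i l j α β).support = {i, j, l} := by
  ext m
  rw [Finsupp.mem_support_iff, Finset.mem_insert, Finset.mem_insert, Finset.mem_singleton]
  by_cases hi : m = i
  · subst hi
    rw [facePoint_apply_fst hil hij]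
    simp
    omega
  by_cases hj : m = j
  · subst hj
    rw [facePoint_apply_thd hij hlj]
    simp
    omega
  by_cases hl : m = l
  · subst hl
    rw [facePoint_apply_snd hil hlj]
    simp
    omega
  · simp [facePoint_apply_of_ne hi hj hl, hi, hj, hl]

/-- The number of elements of `M` in the relative interior of the coordinate face `X`. -/
def interiorCount {V : Type*} [DecidableEq V] (M : Finset (V →₀ ℕ)) (X : Finset V) : ℕ :=
  (M.filter fun a => a.support = X).card

/-- The number of elements of `M` in the coordinate face `T`. -/
def faceCount {V : Type*} [DecidableEq V] (M : Finset (V →₀ ℕ)) (T : Finset V) : ℕ :=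
  (M.filter fun a => a.support ⊆ T).card

theorem sum_interiorCount_le {V ι : Type*} [DecidableEq V] (M : Finset (V →₀ ℕ)) (T : Finset V)
    (s : Finset ι) (f : ι → Finset V) (hf : Set.InjOn f s) (hT : ∀ x ∈ s, f x ⊆ T) :
    ∑ x ∈ s, interiorCount M (f x) ≤ faceCount M T := by
  classical
  unfold interiorCount faceCount
  rw [← Finset.card_biUnion]
  · refine Finset.card_le_card fun a ha => ?_
    obtain ⟨x, hx, ha⟩ := Finset.mem_biUnion.1 ha
    rw [Finset.mem_filter] at ha ⊢
    exact ⟨ha.1, by rw [ha.2]; exact hT x hx⟩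
  · intro x hx y hy hxy
    refine Finset.disjoint_left.2 fun a ha ha' => hxy (hf hx hy ?_)
    rw [Finset.mem_filter] at ha ha'
    rw [← ha.2, ha'.2]

theorem sum_interiorCount_tetrahedron_le {V : Type*} [DecidableEq V] (M : Finset (V →₀ ℕ))
    {T : Finset V} {x y z u : V} (hxy : x ≠ y) (hxz : x ≠ z) (hxu : x ≠ u) (hyz : y ≠ z)
    (hyu : y ≠ u) (hzu : z ≠ u) (hx : x ∈ T) (hy : y ∈ T) (hz : z ∈ T) (hu : u ∈ T) :
    interiorCount M {x, y} + interiorCount M {x, z} + interiorCount M {x, u} +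
      interiorCount M {y, z} + interiorCount M {y, u} + interiorCount M {z, u} +
      (interiorCount M {y, z, u} + interiorCount M {x, z, u} + interiorCount M {x, y, u} +
        interiorCount M {x, y, z}) ≤ faceCount M T := by
  -- Transport from `Fin 4` makes the distinctness of the ten edges and triangles decidable.
  let f : Fin 4 ↪ V := ⟨![x, y, z, u], by
    intro a b h
    fin_cases a <;> fin_cases b <;> simp_all⟩
  have f0 : f 0 = x := rfl
  have f1 : f 1 = y := rfl
  have f2 : f 2 = z := rfl
  have f3 : f 3 = u := rfl
  have h := sum_interiorCount_le M T
    ({{0, 1}, {0, 2}, {0, 3}, {1, 2}, {1, 3}, {2, 3}, {1, 2, 3}, {0, 2, 3}, {0, 1, 3}, {0, 1, 2}} :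
      Finset (Finset (Fin 4))) (fun X => X.map f) (fun X _ Y _ h => Finset.map_injective f h) (by
      intro X _ a ha
      obtain ⟨b, -, rfl⟩ := Finset.mem_map.1 ha
      fin_cases b <;> simpa [f])
  iterate 9 rw [Finset.sum_insert (by decide)] at h
  rw [Finset.sum_singleton] at h
  simp only [Finset.map_insert, Finset.map_singleton, f0, f1, f2, f3] at h
  omega

theorem one_le_interiorCount {V : Type*} [DecidableEq V] {M : Finset (V →₀ ℕ)} {X : Finset V}
    {a : V →₀ ℕ} (ha : a ∈ M) (h : a.support = X) : 1 ≤ interiorCount M X :=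
  Finset.card_pos.2 ⟨a, Finset.mem_filter.2 ⟨ha, h⟩⟩

theorem two_le_interiorCount {V : Type*} [DecidableEq V] {M : Finset (V →₀ ℕ)} {X : Finset V}
    {a b : V →₀ ℕ} (ha : a ∈ M) (h : a.support = X) (hb : b ∈ M) (h' : b.support = X)
    (hab : a ≠ b) : 2 ≤ interiorCount M X :=
  Finset.one_lt_card.2 ⟨a, Finset.mem_filter.2 ⟨ha, h⟩, b, Finset.mem_filter.2 ⟨hb, h'⟩, hab⟩

theorem three_le_interiorCount {V : Type*} [DecidableEq V] {M : Finset (V →₀ ℕ)} {X : Finset V}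
    {a b c : V →₀ ℕ} (ha : a ∈ M) (h : a.support = X) (hb : b ∈ M) (h' : b.support = X)
    (hc : c ∈ M) (h'' : c.support = X) (hab : a ≠ b) (hac : a ≠ c) (hbc : b ≠ c) :
    3 ≤ interiorCount M X :=
  Finset.two_lt_card.2 ⟨a, Finset.mem_filter.2 ⟨ha, h⟩, b, Finset.mem_filter.2 ⟨hb, h'⟩, c,
    Finset.mem_filter.2 ⟨hc, h''⟩, hab, hac, hbc⟩

end Supports

/-! ### Lower bound for the number of non-powers when a power of a variable occurs. -/

section Count

variable {k : Type*} [Field k] {n e : ℕ}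

theorem edgePoint_injective {n d : ℕ} {i j : Fin (n + 1)} (hij : i ≠ j) :
    Function.Injective (edgePoint d i j) := by
  intro a b h
  have := DFunLike.congr_fun h j
  rwa [edgePoint_apply_snd hij, edgePoint_apply_snd hij] at this

theorem edgePoint_zero {n d : ℕ} (i j : Fin (n + 1)) : edgePoint d i j 0 = Finsupp.single i d := by
  simp [edgePoint]

theorem edgePoint_self {n d : ℕ} (i j : Fin (n + 1)) : edgePoint d i j d = Finsupp.single j d := by
  simp [edgePoint]

/-- `M` consists of the monomials, other than powers of variables, of the multiple with
coefficients `φ` of `x_0 + ⋯ + x_n`, and with a monomial `x_i^{d-1} x_j` it contains all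
the monomials in `x_i` and `x_j`. Here `d = e + 1`. -/
structure IsEdgeFull (φ : (Fin (n + 1) →₀ ℕ) → k) (e : ℕ) (M : Finset (Fin (n + 1) →₀ ℕ)) :
    Prop where
  mem : ∀ a : Fin (n + 1) →₀ ℕ, a.degree = e + 1 → (∀ i, a ≠ Finsupp.single i (e + 1)) →
    shiftSum Finset.univ φ a ≠ 0 → a ∈ M
  degree : ∀ a ∈ M, a.degree = e + 1
  full : ∀ i j, i ≠ j → edgePoint (e + 1) i j 1 ∈ M →
    ∀ b, 1 ≤ b → b < e + 1 → edgePoint (e + 1) i j b ∈ M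

variable {φ : (Fin (n + 1) →₀ ℕ) → k} {M : Finset (Fin (n + 1) →₀ ℕ)}

namespace IsEdgeFull

theorem mem_of_support (h : IsEdgeFull φ e M) {a : Fin (n + 1) →₀ ℕ} (ha : a.degree = e + 1)
    {p q : Fin (n + 1)} (hpq : p ≠ q) (hp : a p ≠ 0) (hq : a q ≠ 0)
    (hg : shiftSum Finset.univ φ a ≠ 0) : a ∈ M := by
  refine h.mem a ha (fun i hi => ?_) hg
  rw [hi, Finsupp.single_apply] at hp hq
  split_ifs at hp hq with h1 h2
  · exact hpq (h1.symm.trans h2)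
  all_goals simp_all

theorem edge_mem (h : IsEdgeFull φ e M) {i j : Fin (n + 1)} (hij : i ≠ j) {b : ℕ} (h1 : 1 ≤ b)
    (h2 : b < e + 1) (hg : shiftSum Finset.univ φ (edgePoint (e + 1) i j b) ≠ 0) :
    edgePoint (e + 1) i j b ∈ M := by
  refine h.mem_of_support (degree_edgePoint h2.le) hij ?_ ?_ hg
  · rw [edgePoint_apply_fst hij]; omega
  · rw [edgePoint_apply_snd hij]; omega

theorem symm (h : IsEdgeFull φ e M) (he : 1 ≤ e) {i j : Fin (n + 1)} (hij : i ≠ j)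
    (hm : edgePoint (e + 1) i j 1 ∈ M) : edgePoint (e + 1) j i 1 ∈ M := by
  have := h.full i j hij hm e he (by omega)
  rwa [edgePoint_symm (by omega), Nat.add_sub_cancel_left] at this

theorem three_le (h : IsEdgeFull φ e M) (he : 3 ≤ e) {i j : Fin (n + 1)} (hij : i ≠ j)
    (hm : edgePoint (e + 1) i j 1 ∈ M) : 3 ≤ interiorCount M {i, j} := by
  have hinj := edgePoint_injective (d := e + 1) hij
  exact three_le_interiorCount
    (h.full i j hij hm 1 (by omega) (by omega)) (support_edgePoint hij (by omega) (by omega))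
    (h.full i j hij hm 2 (by omega) (by omega)) (support_edgePoint hij (by omega) (by omega))
    (h.full i j hij hm 3 (by omega) (by omega)) (support_edgePoint hij (by omega) (by omega))
    (hinj.ne (by omega)) (hinj.ne (by omega)) (hinj.ne (by omega))

variable [CharZero k]

theorem one_le (h : IsEdgeFull φ e M) {i j q : Fin (n + 1)} (hij : i ≠ j) (hiq : i ≠ q)
    (hqj : q ≠ j) (hP : ¬ (shiftSum Finset.univ φ (Finsupp.single i (e + 1)) ≠ 0 ↔
      shiftSum Finset.univ φ (Finsupp.single j (e + 1)) ≠ 0)) : 1 ≤ interiorCount M {i, j} := by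
  obtain ⟨b, hb, hbd, hg⟩ := exists_ne_zero_of_sum_eq_zero (Nat.succ_ne_zero e)
    (sum_edge_eq_zero φ hiq hij hqj) (by rwa [edgePoint_zero, edgePoint_self])
  exact one_le_interiorCount (h.edge_mem hij hb hbd hg) (support_edgePoint hij hb hbd)

/-- The line of `x_q`-degree one in the triangle carries no monomial of the product, neither inside
nor at its two ends, so on the edge the product has a double root at `-1`. -/
theorem edgeBound (h : IsEdgeFull φ e M) {i j q : Fin (n + 1)} (hij : i ≠ j)
    (hiq : i ≠ q) (hqj : q ≠ j) (hline : ∀ a ∈ M, a.support = {i, j, q} → a q ≠ 1)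
    (h1 : edgePoint (e + 1) i q 1 ∉ M) (h2 : edgePoint (e + 1) j q 1 ∉ M) (he : 1 ≤ e) :
    EdgeBound (shiftSum Finset.univ φ (Finsupp.single i (e + 1)) ≠ 0)
      (shiftSum Finset.univ φ (Finsupp.single j (e + 1)) ≠ 0) (interiorCount M {i, j}) := by
  have hclean : ∀ b, b ≤ e →
      shiftSum Finset.univ φ (facePoint (e + 1) i q j 1 b) = 0 := by
    intro b hb
    by_contra hg
    by_cases hb0 : b = 0
    · rw [hb0, facePoint_zero_right] at hg
      exact h1 (h.edge_mem hiq le_rfl (by omega) hg)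
    by_cases hbe : b = e
    · have : facePoint (e + 1) i q j 1 b = edgePoint (e + 1) j q 1 := by
        rw [hbe, facePoint, edgePoint, Nat.add_sub_cancel, Nat.sub_self, Finsupp.single_zero,
          zero_add]
        exact add_comm _ _
      rw [this] at hg
      exact h2 (h.edge_mem hqj.symm le_rfl (by omega) hg)
    · refine hline (facePoint (e + 1) i q j 1 b) ?_
        (support_facePoint hiq hij hqj le_rfl (by omega) (by omega))
        (facePoint_apply_snd hiq hqj _ _)
      refine h.mem_of_support (degree_facePoint (by omega)) hqj ?_ ?_ hg
      · rw [facePoint_apply_snd hiq hqj]; omega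
      · rw [facePoint_apply_thd hij hqj]; omega
  obtain ⟨f1, f2⟩ := exists_ne_zero_of_sums_eq_zero (Nat.succ_ne_zero e)
    (sum_edge_eq_zero φ hiq hij hqj) (sum_mul_edge_eq_zero φ hiq hij hqj hclean)
  rw [edgePoint_zero, Nat.succ_eq_add_one, edgePoint_self] at f1 f2
  constructor
  · intro hP
    obtain ⟨b, hb, hbd, hg⟩ := f1 hP
    exact one_le_interiorCount (h.edge_mem hij hb hbd hg) (support_edgePoint hij hb hbd)
  · intro hP
    obtain ⟨b, c, hbc, hb, hbd, hc, hcd, hg, hg'⟩ := f2 hP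
    exact two_le_interiorCount (h.edge_mem hij hb hbd hg) (support_edgePoint hij hb hbd)
      (h.edge_mem hij hc hcd hg') (support_edgePoint hij hc hcd)
      ((edgePoint_injective hij).ne hbc)

/-- The monomials on the edges of a face without full edges, in terms of the number of monomials
inside the face. -/
theorem edgeBound_face (h : IsEdgeFull φ e M) (he : 3 ≤ e) {i j q : Fin (n + 1)} (hij : i ≠ j)
    (hiq : i ≠ q) (hjq : j ≠ q) (h1 : edgePoint (e + 1) i j 1 ∉ M)
    (h2 : edgePoint (e + 1) i q 1 ∉ M) (h3 : edgePoint (e + 1) j q 1 ∉ M) :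
    let P := fun i => shiftSum Finset.univ φ (Finsupp.single i (e + 1)) ≠ 0
    (interiorCount M {i, j, q} = 0 → EdgeBound (P i) (P j) (interiorCount M {i, j}) ∧
      EdgeBound (P i) (P q) (interiorCount M {i, q}) ∧
      EdgeBound (P j) (P q) (interiorCount M {j, q})) ∧
    (interiorCount M {i, j, q} = 1 → EdgeBound (P i) (P j) (interiorCount M {i, j}) ∨
      EdgeBound (P i) (P q) (interiorCount M {i, q}) ∨
      EdgeBound (P j) (P q) (interiorCount M {j, q})) := by
  intro P
  have s1 : edgePoint (e + 1) j i 1 ∉ M := fun hm => h1 (h.symm (by omega) hij.symm hm)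
  have s2 : edgePoint (e + 1) q i 1 ∉ M := fun hm => h2 (h.symm (by omega) hiq.symm hm)
  have s3 : edgePoint (e + 1) q j 1 ∉ M := fun hm => h3 (h.symm (by omega) hjq.symm hm)
  have p1 : ({i, q, j} : Finset (Fin (n + 1))) = {i, j, q} := by
    rw [Finset.pair_comm q j]
  have p2 : ({j, q, i} : Finset (Fin (n + 1))) = {i, j, q} := by
    rw [Finset.pair_comm q i, Finset.insert_comm]
  have e1 := fun hl => h.edgeBound hij hiq hjq.symm hl h2 h3 (by omega)
  have e2 := fun hl => h.edgeBound hiq hij hjq (by rwa [p1]) h1 s3 (by omega)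
  have e3 := fun hl => h.edgeBound hjq hij.symm hiq (by rwa [p2]) s1 s2 (by omega)
  constructor
  · intro h0
    have hno : ∀ a ∈ M, a.support = {i, j, q} → False := by
      intro a ha hs
      have := one_le_interiorCount ha hs
      omega
    exact ⟨e1 fun a ha hs => (hno a ha hs).elim, e2 fun a ha hs => (hno a ha hs).elim,
      e3 fun a ha hs => (hno a ha hs).elim⟩
  · intro h0
    obtain ⟨a, ha⟩ := Finset.card_eq_one.1 h0
    have huniq : ∀ b ∈ M, b.support = {i, j, q} → b = a := by
      intro b hb hs
      have : b ∈ M.filter fun a => a.support = {i, j, q} := Finset.mem_filter.2 ⟨hb, hs⟩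
      rw [ha] at this
      exact Finset.mem_singleton.1 this
    have haM : a ∈ M ∧ a.support = {i, j, q} := by
      have : a ∈ M.filter fun a => a.support = {i, j, q} := by
        rw [ha]
        exact Finset.mem_singleton_self a
      exact Finset.mem_filter.1 this
    have hdeg : a i + (a j + a q) = e + 1 := by
      rw [← h.degree a haM.1, Finsupp.degree_apply, haM.2, Finset.sum_insert (by simp [hij, hiq]),
        Finset.sum_pair hjq]
    -- The single interior monomial blocks an edge only if its opposite coordinate is `1`. Since the
    -- degree is at least `4`, this cannot happen for all three edges.
    by_cases hq : a q = 1
    · by_cases hj : a j = 1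
      · refine Or.inr (Or.inr (e3 fun b hb hs => ?_))
        rw [huniq b hb hs]
        omega
      · exact Or.inr (Or.inl (e2 fun b hb hs => by rwa [huniq b hb hs]))
    · exact Or.inl (e1 fun b hb hs => by rwa [huniq b hb hs])

/-- Two full edges already contribute six monomials, so at most one edge is full; it is labelled
`{x, y}`, and the arithmetic lemmas apply. -/
theorem six_le_of_card_eq_four (h : IsEdgeFull φ e M) (he : 3 ≤ e) {T : Finset (Fin (n + 1))}
    (hT : T.card = 4) (hP : ∃ i ∈ T, shiftSum Finset.univ φ (Finsupp.single i (e + 1)) ≠ 0) :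
    6 ≤ faceCount M T := by
  by_contra hlt
  set P : Fin (n + 1) → Prop :=
    fun i => shiftSum Finset.univ φ (Finsupp.single i (e + 1)) ≠ 0 with hPdef
  -- two full edges have too many monomials
  have two : ∀ {x y z u : Fin (n + 1)}, x ≠ y → z ≠ u → x ∈ T → y ∈ T → z ∈ T → u ∈ T →
      ({x, y} : Finset (Fin (n + 1))) ≠ {z, u} → edgePoint (e + 1) x y 1 ∈ M →
        edgePoint (e + 1) z u 1 ∉ M := by
    intro x y z u hxy hzu hx hy hz hu hne h1 h2
    have := sum_interiorCount_le M T {{x, y}, {z, u}} id (Set.injOn_id _) (by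
      intro X hX
      rw [Finset.mem_insert, Finset.mem_singleton] at hX
      rcases hX with rfl | rfl
      · exact Finset.insert_subset hx (Finset.singleton_subset_iff.2 hy)
      · exact Finset.insert_subset hz (Finset.singleton_subset_iff.2 hu))
    rw [Finset.sum_pair hne] at this
    have h3 := h.three_le he hxy h1
    have h4 := h.three_le he hzu h2
    simp only [id] at this
    omega
  obtain ⟨x, y, hx, hy, hxy, hfull⟩ : ∃ x y, x ∈ T ∧ y ∈ T ∧ x ≠ y ∧
      (edgePoint (e + 1) x y 1 ∈ M ∨ ∀ z ∈ T, ∀ u ∈ T, z ≠ u → edgePoint (e + 1) z u 1 ∉ M) := by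
    by_cases hc : ∃ x y, x ∈ T ∧ y ∈ T ∧ x ≠ y ∧ edgePoint (e + 1) x y 1 ∈ M
    · obtain ⟨x, y, hx, hy, hxy, hm⟩ := hc
      exact ⟨x, y, hx, hy, hxy, Or.inl hm⟩
    · push Not at hc
      obtain ⟨x, hx, y, hy, hxy⟩ := Finset.one_lt_card.1 (show 1 < T.card by omega)
      exact ⟨x, y, hx, hy, hxy, Or.inr fun z hz u hu hzu => hc z u hz hu hzu⟩
  have hcard : ((T.erase x).erase y).card = 2 := by
    rw [Finset.card_erase_of_mem (Finset.mem_erase.2 ⟨hxy.symm, hy⟩), Finset.card_erase_of_mem hx,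
      hT]
  obtain ⟨z, u, hzu, hzu'⟩ := Finset.card_eq_two.1 hcard
  have hz : z ∈ (T.erase x).erase y := by rw [hzu']; simp
  have hu : u ∈ (T.erase x).erase y := by rw [hzu']; simp
  simp only [Finset.mem_erase] at hz hu
  obtain ⟨hzy, hzx, hz⟩ := hz
  obtain ⟨huy, hux, hu⟩ := hu
  have hP' : P x ∨ P y ∨ P z ∨ P u := by
    obtain ⟨i, hi, hPi⟩ := hP
    by_cases h1 : i = x
    · subst h1; exact Or.inl hPi
    by_cases h2 : i = y
    · subst h2; exact Or.inr (Or.inl hPi)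
    have : i ∈ ({z, u} : Finset (Fin (n + 1))) := by
      rw [← hzu']
      exact Finset.mem_erase.2 ⟨h2, Finset.mem_erase.2 ⟨h1, hi⟩⟩
    rw [Finset.mem_insert, Finset.mem_singleton] at this
    rcases this with rfl | rfl
    · exact Or.inr (Or.inr (Or.inl hPi))
    · exact Or.inr (Or.inr (Or.inr hPi))
  have hsum := sum_interiorCount_tetrahedron_le M hxy hzx.symm hux.symm hzy.symm huy.symm hzu
    hx hy hz hu
  -- all edges other than `{x, y}` are not full
  have notfull : edgePoint (e + 1) x z 1 ∉ M ∧ edgePoint (e + 1) x u 1 ∉ M ∧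
      edgePoint (e + 1) y z 1 ∉ M ∧ edgePoint (e + 1) y u 1 ∉ M ∧ edgePoint (e + 1) z u 1 ∉ M := by
    rcases hfull with hm | hno
    · have ne : ∀ {p q w : Fin (n + 1)}, (w = p ∨ w = q) → w ≠ x → w ≠ y →
          ({x, y} : Finset (Fin (n + 1))) ≠ {p, q} := by
        intro p q w hw h1 h2 heq
        have : w ∈ ({x, y} : Finset (Fin (n + 1))) := by
          rw [heq]
          simpa using hw
        simp [h1, h2] at this
      exact ⟨two hxy hzx.symm hx hy hx hz (ne (Or.inr rfl) hzx hzy) hm,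
        two hxy hux.symm hx hy hx hu (ne (Or.inr rfl) hux huy) hm,
        two hxy hzy.symm hx hy hy hz (ne (Or.inr rfl) hzx hzy) hm,
        two hxy huy.symm hx hy hy hu (ne (Or.inr rfl) hux huy) hm,
        two hxy hzu hx hy hz hu (ne (Or.inr rfl) hux huy) hm⟩
    · exact ⟨hno x hx z hz hzx.symm, hno x hx u hu hux.symm, hno y hy z hz hzy.symm,
        hno y hy u hu huy.symm, hno z hz u hu hzu⟩
  obtain ⟨n1, n2, n3, n4, n5⟩ := notfull
  have f1 := h.edgeBound_face he hzx.symm hux.symm hzu n1 n2 n5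
  have f0 := h.edgeBound_face he hzy.symm huy.symm hzu n3 n4 n5
  by_cases hm : edgePoint (e + 1) x y 1 ∈ M
  · have := six_le_of_full hP' (h.three_le he hxy hm)
      (h.one_le hzx.symm hxy hzy.symm) (h.one_le hux.symm hxy huy.symm)
      (h.one_le hzy.symm hxy.symm hzx.symm) (h.one_le huy.symm hxy.symm hux.symm)
      (h.one_le hzu hzx hux.symm) f1.1 f1.2 f0.1 f0.2
      (w2 := interiorCount M {x, y, u}) (w3 := interiorCount M {x, y, z})
    omega
  · have f3 := h.edgeBound_face he hxy hzx.symm hzy.symm hm n1 n3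
    have f2 := h.edgeBound_face he hxy hux.symm huy.symm hm n2 n4
    have := six_le_of_clean hP' (h.one_le hxy hzx.symm hzy)
      (h.one_le hzx.symm hxy hzy.symm) (h.one_le hux.symm hxy huy.symm)
      (h.one_le hzy.symm hxy.symm hzx.symm) (h.one_le huy.symm hxy.symm hux.symm)
      (h.one_le hzu hzx hux.symm) f3.1 f3.2 f2.1 f2.2 f1.1 f1.2 f0.1 f0.2
    omega

/-- If some power of a variable occurs in the product, then the monomials of `M` in any set `T` of
at least four variables containing this one number at least `|T| + 2`. -/
theorem card_add_two_le (h : IsEdgeFull φ e M) (he : 3 ≤ e) :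
    ∀ T : Finset (Fin (n + 1)), 4 ≤ T.card →
      (∃ i ∈ T, shiftSum Finset.univ φ (Finsupp.single i (e + 1)) ≠ 0) →
        T.card + 2 ≤ faceCount M T := by
  intro T
  induction hc : T.card generalizing T with
  | zero => intro h4; omega
  | succ t ih =>
  intro h4 hP
  rcases Nat.eq_or_lt_of_le h4 with h4 | h4
  · have := h.six_le_of_card_eq_four he (hc.trans h4.symm) hP
    omega
  obtain ⟨i, hi, hPi⟩ := hP
  obtain ⟨v, hv, hvi⟩ := Finset.exists_mem_ne (show 1 < T.card by omega) i
  have hcard : (T.erase v).card = t := by rw [Finset.card_erase_of_mem hv]; omega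
  have hiv : i ∈ T.erase v := Finset.mem_erase.2 ⟨hvi.symm, hi⟩
  -- If `x_v` occurs in a monomial of `M` on `T`, removing `v` loses at least one monomial and
  -- induction applies.
  by_cases hex : ∃ a ∈ M, a.support ⊆ T ∧ v ∈ a.support
  · obtain ⟨a, haM, haT, hva⟩ := hex
    have hIH := ih _ hcard (by omega) ⟨i, hiv, hPi⟩
    have : faceCount M (T.erase v) < faceCount M T := by
      refine Finset.card_lt_card (Finset.ssubset_iff_subset_ne.2 ⟨fun b hb => ?_, fun heq => ?_⟩)
      · rw [Finset.mem_filter] at hb ⊢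
        exact ⟨hb.1, hb.2.trans (Finset.erase_subset _ _)⟩
      · have : a ∈ M.filter fun a => a.support ⊆ T := Finset.mem_filter.2 ⟨haM, haT⟩
        rw [← heq, Finset.mem_filter] at this
        exact (Finset.mem_erase.1 (this.2 hva)).1 rfl
    omega
  · push Not at hex
    have zero : ∀ X : Finset (Fin (n + 1)), X ⊆ T → v ∈ X → interiorCount M X = 0 := by
      intro X hX hvX
      rw [interiorCount, Finset.card_eq_zero, Finset.filter_eq_empty_iff]
      rintro a ha rfl
      exact hex a ha hX hvX
    -- If `{i, j}` were not full, the triangle `{i, j, v}` would have no full edge and no interior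
    -- monomial, so the edge `{i, v}` would need a monomial. Hence all these edges are full.
    have three : ∀ j ∈ (T.erase v).erase i, 3 ≤ interiorCount M {i, j} := by
      intro j hj
      obtain ⟨hji, hj⟩ := Finset.mem_erase.1 hj
      obtain ⟨hjv, hj⟩ := Finset.mem_erase.1 hj
      have z1 : interiorCount M {i, v} = 0 := zero _ (by
        intro x hx; simp at hx; rcases hx with rfl | rfl <;> assumption) (by simp)
      have z2 : interiorCount M {j, v} = 0 := zero _ (by
        intro x hx; simp at hx; rcases hx with rfl | rfl <;> assumption) (by simp)
      have z3 : interiorCount M {i, j, v} = 0 := zero _ (by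
        intro x hx; simp at hx; rcases hx with rfl | rfl | rfl <;> assumption) (by simp)
      by_cases hm : edgePoint (e + 1) i j 1 ∈ M
      · exact h.three_le he hji.symm hm
      · have m1 : edgePoint (e + 1) i v 1 ∉ M := fun hm => by
          have := h.three_le he hvi.symm hm
          omega
        have m2 : edgePoint (e + 1) j v 1 ∉ M := fun hm => by
          have := h.three_le he hjv hm
          omega
        have := ((h.edgeBound_face he hji.symm hvi.symm hjv hm m1 m2).1 z3).2.1.1 (Or.inl hPi)
        omega
    have hsum := sum_interiorCount_le M T ((T.erase v).erase i) (fun j => {i, j}) (by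
      intro j hj j' _ heq
      have hji := (Finset.mem_erase.1 (Finset.mem_coe.1 hj)).1
      have : j ∈ ({i, j'} : Finset (Fin (n + 1))) := by
        have heq' : ({i, j} : Finset (Fin (n + 1))) = {i, j'} := heq
        rw [← heq']
        simp
      simpa [hji] using this) (by
      intro j hj x hx
      have := Finset.mem_of_mem_erase (Finset.mem_of_mem_erase hj)
      simp at hx
      rcases hx with rfl | rfl <;> assumption)
    have h3 := Finset.sum_le_sum three
    rw [Finset.sum_const, Finset.card_erase_of_mem hiv, hcard, smul_eq_mul] at h3
    omega

end IsEdgeFull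

end Count

/-! ### The final count. -/

section Main

variable {k : Type*} [Field k] {n d : ℕ}

theorem mem_apolarExponents_monomialIdeal {S : Finset (Fin (n + 1) →₀ ℕ)}
    (hS : ∀ a ∈ S, a.degree = d) (a : Fin (n + 1) →₀ ℕ) :
    a ∈ apolarExponents d (monomialIdeal k S) ↔ a.degree = d ∧ a ∉ S := by
  simp only [apolarExponents, Finset.mem_filter, Finset.mem_finsuppAntidiag,
    ← Finsupp.degree_eq_sum, Finset.subset_univ, and_true]
  exact and_congr_right fun ha => not_congr (monomial_mem_monomialIdeal hS ha)

theorem eq_add_single_of_shiftSum_ne_zero {φ : (Fin (n + 1) →₀ ℕ) → k} {p : Fin (n + 1) →₀ ℕ}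
    (hφ : ∀ a, φ a ≠ 0 → a = p) {a : Fin (n + 1) →₀ ℕ} (ha : shiftSum Finset.univ φ a ≠ 0) :
    ∃ m, a = p + Finsupp.single m 1 := by
  obtain ⟨m, -, hm, h⟩ := exists_of_shiftSum_ne_zero ha
  exact ⟨m, by rw [← hφ _ h, Finsupp.sub_single_add_single hm]⟩

theorem card_nonpowers (hd : d ≠ 0) {S : Finset (Fin (n + 1) →₀ ℕ)}
    (hpow : ∀ i, Finsupp.single i d ∈ S) :
    (S.filter fun a => ∀ i, a ≠ Finsupp.single i d).card + (n + 1) = S.card := by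
  classical
  rw [← Finset.card_filter_add_card_filter_not (s := S) fun a => ∀ i, a ≠ Finsupp.single i d]
  congr 1
  have : (S.filter fun a => ¬ ∀ i, a ≠ Finsupp.single i d) =
      Finset.univ.image fun i => Finsupp.single i d := by
    ext a
    simp only [Finset.mem_filter, Finset.mem_image, Finset.mem_univ, true_and, not_forall, not_not]
    exact ⟨fun ⟨_, i, h⟩ => ⟨i, h.symm⟩, fun ⟨i, h⟩ => ⟨h ▸ hpow i, i, h.symm⟩⟩
  rw [this, Finset.card_image_of_injective _ (Finsupp.single_left_injective hd), Finset.card_univ,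
    Fintype.card_fin]

end Main

theorem proposition4p4 {k : Type*} [Field k] [IsAlgClosed k] [CharZero k]
    (n d : ℕ) (hn : 3 ≤ n) (hd : 4 ≤ d) :
    ¬ ∃ I ∈ smoothMinimalMonomialTogliattiSystems k n d,
      Submodule.spanFinrank I = 2 * n + 3 := by
  classical
  rintro ⟨I, ⟨hI, hsmooth⟩, hrank⟩
  obtain ⟨S, rfl, hcard, hdeg, hpow, ⟨φ, hφ, hφd, hφS⟩, hmin⟩ := hI.exists_exponents (by omega)
  rw [hrank] at hcard
  set M := S.filter fun a => ∀ i, a ≠ Finsupp.single i d with hM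
  have hMcard : M.card = n + 2 := by
    have : M.card + (n + 1) = S.card := card_nonpowers (by omega) hpow
    omega
  -- For a monomial `ψ`, minimality puts all of `M` among the `n + 1` products of `p` with a
  -- variable, but `M` has `n + 2` elements.
  have hmono : ∀ (ψ : (Fin (n + 1) →₀ ℕ) → k) (p : Fin (n + 1) →₀ ℕ), ψ p ≠ 0 → p.degree + 1 = d →
      (∀ a, ψ a ≠ 0 → a = p) → ¬ ∀ a, shiftSum Finset.univ ψ a ≠ 0 → a ∈ S := by
    intro ψ p hp hpd huniq hψS
    have hsub : M ⊆ Finset.univ.image fun m => p + Finsupp.single m 1 := by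
      intro a ha
      obtain ⟨ha, hne⟩ := Finset.mem_filter.1 ha
      rcases hmin ψ (fun h => hp (congrFun h p)) (fun a h => huniq a h ▸ hpd) hψS a ha with
        ⟨i, hi⟩ | h
      · exact (hne i hi).elim
      · obtain ⟨m, hm⟩ := eq_add_single_of_shiftSum_ne_zero huniq h
        exact Finset.mem_image.2 ⟨m, Finset.mem_univ m, hm.symm⟩
    have := (Finset.card_le_card hsub).trans Finset.card_image_le
    rw [Finset.card_univ, Fintype.card_fin] at this
    omega
  -- Otherwise all monomials of `x_i^(d-1) (x_0 + ⋯ + x_n)` would be generators, against `hmono`.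
  have hJ : ∀ i, ∃ j, j ≠ i ∧ edgePoint d i j 1 ∉ S := by
    intro i
    by_contra! hall
    refine hmono (Pi.single (Finsupp.single i (d - 1)) 1) (Finsupp.single i (d - 1)) (by simp)
      (by rw [Finsupp.degree_single]; omega)
      (fun a ha => by by_contra hc; exact ha (Pi.single_eq_of_ne hc _)) fun a ha => ?_
    obtain ⟨m, rfl⟩ := eq_add_single_of_shiftSum_ne_zero
      (fun a ha => by by_contra hc; exact ha (Pi.single_eq_of_ne hc _)) ha
    by_cases hm : m = i
    · rw [hm, ← Finsupp.single_add, Nat.sub_add_cancel (by omega)]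
      exact hpow i
    · exact hall m hm
  have hedge := fun {i l : Fin (n + 1)} (hil : i ≠ l) (hl : edgePoint d i l 1 ∈ S) {α : ℕ} =>
    edgePoint_mem_of_smooth hn hd hcard.le hpow (mem_apolarExponents_monomialIdeal hdeg) hsmooth hJ
      hil hl (α := α)
  obtain ⟨e, rfl⟩ : ∃ e, d = e + 1 := ⟨d - 1, by omega⟩
  have hfull : IsEdgeFull φ e M :=
    { mem := fun a _ hne ha => Finset.mem_filter.2 ⟨hφS a ha, hne⟩
      degree := fun a ha => hdeg a (Finset.mem_filter.1 ha).1
      full := fun i j hij h b h1 h2 => by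
        refine Finset.mem_filter.2 ⟨hedge hij (Finset.mem_filter.1 h).1 h2.le, fun m hm => ?_⟩
        have hs := support_edgePoint hij h1 h2
        rw [hm] at hs
        have := Finset.card_le_card (hs ▸ Finsupp.support_single_subset)
        rw [Finset.card_singleton, Finset.card_pair hij] at this
        omega }
  -- If a power occurs, `M` has at least `n + 3` elements; if none does, it contains the at least
  -- `2n` monomials of the product. Both exceed `n + 2`.
  by_cases hP : ∃ i, shiftSum Finset.univ φ (Finsupp.single i (e + 1)) ≠ 0
  · obtain ⟨i, hi⟩ := hP
    have h := hfull.card_add_two_le (by omega) Finset.univ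
      (by rw [Finset.card_univ, Fintype.card_fin]; omega) ⟨i, Finset.mem_univ i, hi⟩
    rw [Finset.card_univ, Fintype.card_fin] at h
    have : faceCount M Finset.univ ≤ M.card := Finset.card_filter_le _ _
    omega
  · push Not at hP
    have hsub : Function.support (shiftSum Finset.univ φ) ⊆ M := by
      intro a ha
      exact Finset.mem_filter.2 ⟨hφS a ha, fun i hi => ha (hi ▸ hP i)⟩
    have hle := Set.ncard_le_ncard hsub M.finite_toSet
    rw [Set.ncard_coe_finset, hMcard] at hle
    have hfin : (Function.support φ).Finite := by
      refine (Finset.univ.finsuppAntidiag e).finite_toSet.subset fun a ha => ?_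
      rw [Finset.mem_coe, Finset.mem_finsuppAntidiag, ← Finsupp.degree_eq_sum]
      exact ⟨by have := hφd a ha; omega, Finset.subset_univ _⟩
    obtain ⟨p, hp⟩ := Function.ne_iff.1 hφ
    have hnt : (Function.support φ).Nontrivial := by
      by_contra hc
      exact hmono φ p hp (hφd p hp)
        (fun a ha => Set.not_nontrivial_iff.1 hc ha hp) hφS
    have := two_mul_card_le_ncard_support_shiftSum Finset.univ φ hfin
      (fun a b ha hb => ⟨by have := hφd a ha; have := hφd b hb; omega,
        fun i hi => (hi (Finset.mem_univ i)).elim⟩) hnt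
    rw [Finset.card_univ, Fintype.card_fin] at this
    omega
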